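/- Let $\mathcal G$ be a metric graph, i.e. the quotient of a disjoint union $\bigsqcup_{e\in E}[0,\ell_e]$ ($E$ finite or countably infinite, $0<\ell_e<\infty$) by an equivalence relation on the set of endpoints of the edges; the equivalence classes of endpoints are the vertices, and loops and parallel edges are allowed. Assume that $\mathcal G$ is non-empty, connected, locally finite (every vertex has finite degree) and has finite total length $\sum_e \ell_e<\infty$. A *compact exhaustion* of $\mathcal G$ is a sequence of connected induced subgraphs $\mathcal G_1\subset\mathcal G_2\subset\dots\subset\mathcal G$, each with a finite non-empty edge set, such that every edge of $\mathcal G$ lies in some $\mathcal G_n$. (A subgraph is given by a set of edges and their endpoints; it is induced if it contains every edge of $\mathcal G$ both of whose end vertices belong to it.) Let $\partial\mathcal G_n$ be the set of vertices of $\mathcal G_n$ that lie in the topological boundary of $\mathcal G_n$ in $\mathcal G$. Let $L^2(\mathcal G)=\bigoplus_e L^2(0,\ell_e)$ be real-valued, let $H^1(\mathcal G)$ be the space of continuous functions on $\mathcal G$ that are in $H^1$ on every edge, with $\sum_e\|f_e\|_{H^1(e)}^2<\infty$, and let $H^1_0(\mathcal G)$ be the closure in $H^1(\mathcal G)$ of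 the functions vanishing outside a compact subset of $\mathcal G$. The form $f\mapsto\int|f'|^2$ with domain $H^1(\mathcal G)$, respectively $H^1_0(\mathcal G)$, defines the Neumann extension $\mathcal H_{\mathrm N}$, respectively the Friedrichs extension $\mathcal H_{\mathrm F}$, of the Laplacian on $L^2(\mathcal G)$. On $L^2(\mathcal G_n)$, the same form with domain $H^1(\mathcal G_n)$ defines the Laplacian with standard (continuity and Kirchhoff) conditions at all vertices, and with domain $\{f\in H^1(\mathcal G_n): f=0\text{ on }\partial\mathcal G_n\}$ the Laplacian with Dirichlet conditions on $\partial\mathcal G_n$ and standard conditions at all other vertices. Then for every compact exhaustion $(\mathcal G_n)_{n\ge1}$ all these operators have purely discrete spectrum. Denote their eigenvalues, in increasing order, repeated according to multiplicity and numbered by $k=1,2,\dots$, by $\mu_k(\mathcal G)$ (for $\mathcal H_{\mathrm N}$), $\lambda_k(\mathcal G)$ (for $\mathcal H_{\mathrm F}$), $\mu_k(\mathcal G_n)$ (standard conditions on $\mathcal G_n$) and $\lambda_k(\mathcal G_n)$ (Dirichlet conditions on $\partial\mathcal G_n$). Then: 1. For all $k\ge1$ and all $n$, $\lambda_k(\mathcal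 G_n)\ge\lambda_k(\mathcal G)$, and $\lambda_k(\mathcal G_n)\to\lambda_k(\mathcal G)$ as $n\to\infty$. 2. For all $k\ge1$, $\mu_k(\mathcal G)\ge\limsup_{n\to\infty}\mu_k(\mathcal G_n)$. 3. If in addition the first Betti number of $\mathcal G$ (the dimension of its cycle space) is finite, then for every $k\ge1$ we have $\mu_k(\mathcal G_n)\ge\mu_k(\mathcal G)$ for all sufficiently large $n$. -/

import Mathlib

open MeasureTheory Filter Topology
open scoped ENNReal

noncomputable section

/-- Combinatorial and metric data of a metric graph with edge set `E`: positive edge lengths and an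
equivalence relation on the endpoints of the edges.  The pair `(e, false)` stands for the endpoint
`0` of `[0, len e]` and `(e, true)` for the endpoint `len e`.  Loops and parallel edges are
allowed. -/
structure MetricGraph (E : Type*) where
  len : E → ℝ
  len_pos : ∀ e, 0 < len e
  rel : Setoid (E × Bool)

namespace MetricGraph

variable {E : Type*} (G : MetricGraph E)

/-- The vertices are the equivalence classes of endpoints. -/
def Vertex : Type _ := Quotient G.rel

/-- The vertex at an end of an edge. -/
def vertexAt (a : E × Bool) : G.Vertex := Quotient.mk G.rel a

/-- The disjoint union of the intervals `[0, len e]`. -/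
abbrev Edges : Type _ := Σ e : E, Set.Icc (0 : ℝ) (G.len e)

/-- The endpoint of an edge as a point of the disjoint union of the edges. -/
def endpoint (a : E × Bool) : G.Edges :=
  ⟨a.1, if a.2 then ⟨G.len a.1, (G.len_pos a.1).le, le_rfl⟩ else ⟨0, le_rfl, (G.len_pos a.1).le⟩⟩

/-- Endpoints are glued when they belong to the same vertex. -/
def Glue (p q : G.Edges) : Prop :=
  ∃ a b : E × Bool, G.rel a b ∧ p = G.endpoint a ∧ q = G.endpoint b

/-- The metric graph as a space: the quotient of the disjoint union of the edges. -/
def Space : Type _ := Quot G.Glue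

/-- The quotient topology; for a locally finite graph this is the topology of the path metric. -/
instance : TopologicalSpace G.Space := inferInstanceAs (TopologicalSpace (Quot G.Glue))

/-- The point with coordinate `x ∈ [0, len e]` on the edge `e` (other `x` are first projected
to this interval). -/
def pt (e : E) (x : ℝ) : G.Space :=
  Quot.mk G.Glue ⟨e, Set.projIcc 0 (G.len e) (G.len_pos e).le x⟩

/-- Every vertex has finite degree (loops count twice). -/
def LocallyFinite : Prop := ∀ v : G.Vertex, {a : E × Bool | G.vertexAt a = v}.Finite

/-- Connected (and non-empty). -/
def IsConnected : Prop := ConnectedSpace G.Space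

/-- The total length. -/
def totalLength : ℝ≥0∞ := ∑' e, ENNReal.ofReal (G.len e)

/-- The boundary map from edge chains to vertex chains. -/
def boundaryMap : (E →₀ ℝ) →ₗ[ℝ] (G.Vertex →₀ ℝ) :=
  Finsupp.linearCombination ℝ fun e =>
    Finsupp.single (G.vertexAt (e, true)) (1 : ℝ) - Finsupp.single (G.vertexAt (e, false)) (1 : ℝ)

/-- The first Betti number: the number of elements of a basis of the cycle space. -/
def betti : ℕ∞ := Cardinal.toENat (Module.rank ℝ (LinearMap.ker G.boundaryMap))

/-! ### Subgraphs and compact exhaustions -/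

/-- The subgraph with edge set `S`; its vertices are the endpoints of the edges in `S`. -/
def subgraph (S : Set E) : MetricGraph S where
  len e := G.len e
  len_pos e := G.len_pos e
  rel := G.rel.comap fun a => ((a.1 : E), a.2)

/-- The vertices of `G` that belong to the subgraph with edge set `S`. -/
def verticesOf (S : Set E) : Set G.Vertex := {v | ∃ a : E × Bool, a.1 ∈ S ∧ G.vertexAt a = v}

/-- The subgraph is induced: it contains all edges of `G` that connect vertices of it. -/
def IsInduced (S : Set E) : Prop :=
  ∀ e, G.vertexAt (e, false) ∈ G.verticesOf S → G.vertexAt (e, true) ∈ G.verticesOf S → e ∈ S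

/-- The inclusion of a subgraph as a map of spaces. -/
def incl (S : Set E) : (G.subgraph S).Space → G.Space :=
  Quot.map (fun p => ⟨(p.1 : E), p.2⟩) (by
    rintro _ _ ⟨a, b, hab, rfl, rfl⟩
    exact ⟨((a.1 : E), a.2), ((b.1 : E), b.2), hab, rfl, rfl⟩)

/-- The topological boundary of a subgraph in `G`, as a set of points of the subgraph. -/
def bdry (S : Set E) : Set (G.subgraph S).Space :=
  G.incl S ⁻¹' frontier (Set.range (G.incl S))

/-- A compact exhaustion: an increasing sequence of finite connected induced subgraphs which
eventually contains every edge. -/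
structure IsCompactExhaustion (K : ℕ → Set E) : Prop where
  induced : ∀ n, G.IsInduced (K n)
  mono : ∀ n, K n ⊆ K (n + 1)
  exhaust : ∀ e, ∃ n, e ∈ K n
  connected : ∀ n, (G.subgraph (K n)).IsConnected
  compact : ∀ n, (K n).Finite

/-! ### Lebesgue and Sobolev spaces -/

/-- `L²` of the edge `e`. -/
abbrev EdgeL2 (e : E) : Type _ := Lp ℝ 2 (volume.restrict (Set.Icc (0 : ℝ) (G.len e)))

/-- `L²` of the graph: the Hilbert sum of the `L²` spaces of the edges. -/
abbrev L2 : Type _ := lp (fun e => G.EdgeL2 e) 2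

/-- `f` is a continuous function on the graph which lies in `H¹`, its `L²` class is `u` and its
derivative is `g`: on every edge `f` is the indefinite integral of the `L²` function `g e`
(that is, `f` is absolutely continuous there, with derivative `g e`). -/
structure IsSobolev (f : G.Space → ℝ) (u g : G.L2) : Prop where
  cont : Continuous f
  ae_eq : ∀ e, ∀ᵐ x ∂(volume.restrict (Set.Icc (0 : ℝ) (G.len e))), u e x = f (G.pt e x)
  integral_eq : ∀ e, ∀ x ∈ Set.Icc (0 : ℝ) (G.len e),
    f (G.pt e x) = f (G.pt e 0) + ∫ s in (0 : ℝ)..x, g e s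

variable {G}

lemma EdgeL2.intervalIntegrable {e : E} (g : G.EdgeL2 e) {x : ℝ}
    (hx : x ∈ Set.Icc (0 : ℝ) (G.len e)) : IntervalIntegrable g volume 0 x := by
  have h : Integrable g (volume.restrict (Set.Icc (0 : ℝ) (G.len e))) :=
    (Lp.memLp g).integrable (by norm_num)
  rw [intervalIntegrable_iff_integrableOn_Icc_of_le hx.1]
  exact IntegrableOn.mono_set h (Set.Icc_subset_Icc le_rfl hx.2)

lemma EdgeL2.integral_congr {e : E} {g h : ℝ → ℝ} {x : ℝ}
    (hx : x ∈ Set.Icc (0 : ℝ) (G.len e))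
    (hgh : g =ᵐ[volume.restrict (Set.Icc (0 : ℝ) (G.len e))] h) :
    ∫ s in (0 : ℝ)..x, g s = ∫ s in (0 : ℝ)..x, h s := by
  rw [intervalIntegral.integral_of_le hx.1, intervalIntegral.integral_of_le hx.1]
  refine MeasureTheory.integral_congr_ae ?_
  refine ae_restrict_of_ae_restrict_of_subset ?_ hgh
  exact Set.Ioc_subset_Icc_self.trans (Set.Icc_subset_Icc le_rfl hx.2)

lemma IsSobolev.zero : G.IsSobolev (fun _ => 0) 0 0 where
  cont := continuous_const
  ae_eq e := by
    filter_upwards [Lp.coeFn_zero ℝ 2 (volume.restrict (Set.Icc (0 : ℝ) (G.len e)))] with x hx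
    exact hx
  integral_eq e x hx := by
    have h := EdgeL2.integral_congr hx
      (Lp.coeFn_zero ℝ 2 (volume.restrict (Set.Icc (0 : ℝ) (G.len e))))
    have h' : ∫ s in (0 : ℝ)..x, (0 : G.L2) e s = 0 := by
      refine h.trans ?_
      simp
    rw [h']
    simp

lemma IsSobolev.add {f₁ f₂ : G.Space → ℝ} {u₁ g₁ u₂ g₂ : G.L2} (h₁ : G.IsSobolev f₁ u₁ g₁)
    (h₂ : G.IsSobolev f₂ u₂ g₂) : G.IsSobolev (fun x => f₁ x + f₂ x) (u₁ + u₂) (g₁ + g₂) where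
  cont := h₁.cont.add h₂.cont
  ae_eq e := by
    filter_upwards [Lp.coeFn_add (u₁ e) (u₂ e), h₁.ae_eq e, h₂.ae_eq e] with x hx hx₁ hx₂
    rw [← hx₁, ← hx₂]
    exact hx
  integral_eq e x hx := by
    have h : ∫ s in (0 : ℝ)..x, (g₁ + g₂) e s = ∫ s in (0 : ℝ)..x, (g₁ e s + g₂ e s) :=
      EdgeL2.integral_congr hx (Lp.coeFn_add (g₁ e) (g₂ e))
    rw [h, intervalIntegral.integral_add (EdgeL2.intervalIntegrable _ hx)
      (EdgeL2.intervalIntegrable _ hx), h₁.integral_eq e x hx, h₂.integral_eq e x hx]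
    ring

lemma IsSobolev.smul (c : ℝ) {f : G.Space → ℝ} {u g : G.L2} (h : G.IsSobolev f u g) :
    G.IsSobolev (fun x => c * f x) (c • u) (c • g) where
  cont := continuous_const.mul h.cont
  ae_eq e := by
    filter_upwards [Lp.coeFn_smul c (u e), h.ae_eq e] with x hx hx₁
    rw [← hx₁]
    exact hx
  integral_eq e x hx := by
    have h' : ∫ s in (0 : ℝ)..x, (c • g) e s = ∫ s in (0 : ℝ)..x, c * g e s :=
      EdgeL2.integral_congr hx (Lp.coeFn_smul c (g e))
    rw [h', intervalIntegral.integral_const_mul, h.integral_eq e x hx]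
    ring

variable (G)

/-- The Sobolev space `H¹` with its `H¹` topology: `f` is recorded as the pair `(f, f')` in
`L² × L²`. -/
def H1 : Submodule ℝ (G.L2 × G.L2) where
  carrier := {p | ∃ f, G.IsSobolev f p.1 p.2}
  zero_mem' := ⟨_, IsSobolev.zero⟩
  add_mem' := by
    rintro p q ⟨f₁, h₁⟩ ⟨f₂, h₂⟩
    exact ⟨_, h₁.add h₂⟩
  smul_mem' := by
    rintro c p ⟨f, h⟩
    exact ⟨_, h.smul c⟩

/-- The functions in `H¹` that vanish outside a compact subset of the graph. -/
def H1c : Submodule ℝ (G.L2 × G.L2) where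
  carrier := {p | ∃ f, G.IsSobolev f p.1 p.2 ∧ ∃ C : Set G.Space, IsCompact C ∧ ∀ x ∉ C, f x = 0}
  zero_mem' := ⟨_, IsSobolev.zero, ∅, isCompact_empty, fun _ _ => rfl⟩
  add_mem' := by
    rintro p q ⟨f₁, h₁, C₁, hC₁, hf₁⟩ ⟨f₂, h₂, C₂, hC₂, hf₂⟩
    refine ⟨_, h₁.add h₂, C₁ ∪ C₂, hC₁.union hC₂, fun x hx => ?_⟩
    rw [Set.mem_union, not_or] at hx
    simp [hf₁ x hx.1, hf₂ x hx.2]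
  smul_mem' := by
    rintro c p ⟨f, h, C, hC, hf⟩
    exact ⟨_, h.smul c, C, hC, fun x hx => by simp [hf x hx]⟩

/-- `H¹₀`: the closure of the compactly supported functions in `H¹`. -/
def H10 : Submodule ℝ (G.L2 × G.L2) := G.H1 ⊓ G.H1c.topologicalClosure

/-- The functions in `H¹` that vanish on the set `A` of points of the graph. -/
def H1Vanishing (A : Set G.Space) : Submodule ℝ (G.L2 × G.L2) where
  carrier := {p | ∃ f, G.IsSobolev f p.1 p.2 ∧ ∀ x ∈ A, f x = 0}
  zero_mem' := ⟨_, IsSobolev.zero, fun _ _ => rfl⟩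
  add_mem' := by
    rintro p q ⟨f₁, h₁, hf₁⟩ ⟨f₂, h₂, hf₂⟩
    exact ⟨_, h₁.add h₂, fun x hx => by simp [hf₁ x hx, hf₂ x hx]⟩
  smul_mem' := by
    rintro c p ⟨f, h, hf⟩
    exact ⟨_, h.smul c, fun x hx => by simp [hf x hx]⟩

end MetricGraph

/-! ### Operators associated with forms, and their eigenvalues -/

section Operators

variable {H : Type*} [NormedAddCommGroup H] [InnerProductSpace ℝ H]

/-- Let `D` be a space of pairs `(v, v')`.  This is (the graph of) the operator associated with the
form `(v, w) ↦ ⟪v', w'⟫` on `D`: `u` is in its domain with image `w` when `u` is in the form domain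
and the form of `u` and `v` is `⟪w, v⟫` for all `v` in the form domain. -/
def formOperator (D : Submodule ℝ (H × H)) : Submodule ℝ (H × H) where
  carrier := {p | ∃ g, (p.1, g) ∈ D ∧ ∀ q ∈ D, inner ℝ g q.2 = inner ℝ p.2 q.1}
  zero_mem' := ⟨0, D.zero_mem, fun q _ => by simp⟩
  add_mem' := by
    rintro p q ⟨g, hg, hg'⟩ ⟨k, hk, hk'⟩
    exact ⟨g + k, D.add_mem hg hk, fun r hr => by
      simp [inner_add_left, hg' r hr, hk' r hr]⟩
  smul_mem' := by
    rintro c p ⟨g, hg, hg'⟩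
    exact ⟨c • g, D.smul_mem c hg, fun r hr => by
      simp [inner_smul_left, hg' r hr]⟩

/-- The eigenspace `{u | T u = s u}` of the operator with graph `T`. -/
def opEigenspace (T : Submodule ℝ (H × H)) (s : ℝ) : Submodule ℝ H :=
  T.comap (LinearMap.prod LinearMap.id (s • LinearMap.id))

/-- The span of the eigenfunctions for eigenvalues at most `t`. -/
def opEigenspaceLE (T : Submodule ℝ (H × H)) (t : ℝ) : Submodule ℝ H :=
  ⨆ s : Set.Iic t, opEigenspace T s

/-- Purely discrete spectrum, for an operator that is bounded below: up to any level there are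
only finitely many eigenvalues, with multiplicity, and the eigenfunctions span a dense subspace. -/
def HasPurelyDiscreteSpectrum (T : Submodule ℝ (H × H)) : Prop :=
  (∀ t, FiniteDimensional ℝ (opEigenspaceLE T t)) ∧
    (⨆ s : ℝ, opEigenspace T s).topologicalClosure = ⊤

/-- The `k`-th eigenvalue (`k ≥ 1`), in increasing order with multiplicities: the least level up to
which there are at least `k` eigenvalues. It is `⊤` if there are fewer than `k` eigenvalues. -/
def kthEigenvalue (T : Submodule ℝ (H × H)) (k : ℕ) : EReal :=
  ⨅ (t : ℝ) (_ : (k : Cardinal) ≤ Module.rank ℝ (opEigenspaceLE T t)), (t : EReal)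

end Operators

namespace MetricGraph

variable {E : Type*} (G : MetricGraph E)

/-- The Neumann extension: the Laplacian associated with the form on `H¹`. -/
def neumannLaplacian : Submodule ℝ (G.L2 × G.L2) := formOperator G.H1

/-- The Friedrichs extension: the Laplacian associated with the form on `H¹₀`. -/
def friedrichsLaplacian : Submodule ℝ (G.L2 × G.L2) := formOperator G.H10

/-- The Laplacian on the subgraph with edge set `S` with Dirichlet conditions on its topological
boundary in `G` and standard conditions at all other vertices. -/
def dirichletLaplacianOn (S : Set E) :
    Submodule ℝ ((G.subgraph S).L2 × (G.subgraph S).L2) :=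
  formOperator ((G.subgraph S).H1Vanishing (G.bdry S))

/-- The Laplacian on the subgraph with edge set `S` with standard conditions at all vertices. -/
def neumannLaplacianOn (S : Set E) :
    Submodule ℝ ((G.subgraph S).L2 × (G.subgraph S).L2) :=
  (G.subgraph S).neumannLaplacian

end MetricGraph

end

/-! All four claims come from the min-max principle. A form domain is kept as a space `D` of pairs
`(v, v')`. If `D` is closed, densely defined and compactly embedded (`IsDiscreteForm`), and `J` is
the embedding of `D` in the Hilbert space, then `J* J` is a compact symmetric operator on `D` whose
eigenvalue `1 / (1 + s)` corresponds to the eigenvalue `s` of the form operator. The spectral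
theorem then gives discrete spectrum and both halves of min-max: `k` pairs satisfying `IsFormBelow
t` force the `k`-th eigenvalue to be at most `t`, and such pairs exist for every `t` above it.

Compactness of the embedding for graphs (`isCompactForm_H1`) rests on finite total length. On a
connected graph a Sobolev function is bounded by its Sobolev norm, so all but finitely many edges
contribute little to the `L²` norm; on the remaining edges the function is small once its means over
short subintervals vanish.

The comparisons move test functions between the graph and its subgraphs. Extension by zero of a
function vanishing on the boundary keeps the energy, whence the lower bound for Dirichlet
eigenvalues. Conversely, a compactly supported function restricts to one vanishing on the boundary
of every large subgraph; such functions are a core for the Friedrichs form, and `IsFormBelow t` is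
an open condition, so the upper limit is controlled. In the Neumann case every Sobolev function may
be restricted. If the Betti number is finite, a large subgraph contains all cycles, so a component
of its complement touches it in at most one vertex; extending by constants there keeps the energy
and does not decrease the norm. -/

noncomputable section

/-! ### Compact symmetric operators. -/

section Spectral

variable {H : Type*} [NormedAddCommGroup H] [InnerProductSpace ℝ H]

/-- The quadratic form of a symmetric operator is at most `c` times the square of the norm on the
span of eigenspaces with eigenvalues at most `c`. -/
theorem LinearMap.IsSymmetric.inner_le_of_mem_iSup_eigenspace {T : H →ₗ[ℝ] H} (hT : T.IsSymmetric)
    {I : Set ℝ} {c : ℝ} (hI : ∀ m ∈ I, m ≤ c) {u : H}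
    (hu : u ∈ ⨆ m : I, Module.End.eigenspace T m) : inner ℝ (T u) u ≤ c * ‖u‖ ^ 2 := by
  classical
  obtain ⟨f, hf, rfl⟩ := (Submodule.mem_iSup_iff_exists_finsupp _ _).1 hu
  have horth : ∀ i j, i ≠ j → inner ℝ (f i) (f j) = 0 := fun i j hij => by
    have := hT.orthogonalFamily_eigenspaces (i := (i : ℝ)) (j := (j : ℝ))
      (fun h => hij (Subtype.ext h)) ⟨f i, hf i⟩ ⟨f j, hf j⟩
    simpa using this
  have hTf : ∀ i, T (f i) = (i : ℝ) • f i := fun i => Module.End.mem_eigenspace_iff.1 (hf i)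
  rw [← real_inner_self_eq_norm_sq]
  simp only [Finsupp.sum, map_sum, hTf, sum_inner, inner_sum, real_inner_smul_left]
  rw [Finset.mul_sum]
  refine Finset.sum_le_sum fun i hi => ?_
  rw [Finset.sum_eq_single i (fun j _ hj => by simp [horth _ _ hj]) (by simp_all),
    Finset.sum_eq_single i (fun j _ hj => by simp [horth _ _ hj]) (by simp_all)]
  exact mul_le_mul_of_nonneg_right (hI i i.2) real_inner_self_nonneg

/-- The previous bound applied to `-T`, whose eigenvalues are the negatives. -/
theorem LinearMap.IsSymmetric.le_inner_of_mem_iSup_eigenspace {T : H →ₗ[ℝ] H} (hT : T.IsSymmetric)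
    {I : Set ℝ} {c : ℝ} (hI : ∀ m ∈ I, c ≤ m) {u : H}
    (hu : u ∈ ⨆ m : I, Module.End.eigenspace T m) : c * ‖u‖ ^ 2 ≤ inner ℝ (T u) u := by
  have hT' : (-T).IsSymmetric := fun x y => by simp [hT x y]
  have key := hT'.inner_le_of_mem_iSup_eigenspace (I := Neg.neg ⁻¹' I) (c := -c) (u := u)
    (fun m hm => by linarith [hI _ hm]) ?_
  · simp at key
    linarith
  · have hle : ⨆ m : I, Module.End.eigenspace T (m : ℝ) ≤
        ⨆ m : (Neg.neg ⁻¹' I : Set ℝ), Module.End.eigenspace (-T) (m : ℝ) := iSup_le fun m => ?_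
    · exact hle hu
    refine le_trans ?_ (le_iSup _ (⟨-(m : ℝ), by simp⟩ : Neg.neg ⁻¹' I))
    intro x hx
    rw [Module.End.mem_eigenspace_iff] at hx ⊢
    simp [hx]

/-- Eigenspaces of a symmetric operator to disjoint sets of eigenvalues are orthogonal. -/
theorem LinearMap.IsSymmetric.isOrtho_iSup_eigenspace {T : H →ₗ[ℝ] H} (hT : T.IsSymmetric)
    {I I' : Set ℝ} (hI : Disjoint I I') :
    (⨆ m : I, Module.End.eigenspace T (m : ℝ)) ⟂ ⨆ m : I', Module.End.eigenspace T (m : ℝ) := by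
  rw [Submodule.isOrtho_iSup_left]
  intro i
  rw [Submodule.isOrtho_iSup_right]
  intro j
  exact hT.orthogonalFamily_eigenspaces.isOrtho (fun h => Set.disjoint_left.1 hI i.2 (h ▸ j.2))

/-- For a compact symmetric operator, the quadratic form is at most `c` times the square of the norm
on the orthogonal complement of the span of the eigenspaces with eigenvalues at least `c`. -/
theorem ContinuousLinearMap.inner_le_of_mem_orthogonal_iSup_eigenspace [CompleteSpace H]
    {T : H →L[ℝ] H} (hc : IsCompactOperator T) (hT : (T : H →ₗ[ℝ] H).IsSymmetric) {c : ℝ} {u : H}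
    (hu : u ∈ (⨆ m : Set.Ici c, Module.End.eigenspace (T : H →ₗ[ℝ] H) m)ᗮ) :
    inner ℝ (T u) u ≤ c * ‖u‖ ^ 2 := by
  set V := ⨆ m : Set.Iio c, Module.End.eigenspace (T : H →ₗ[ℝ] H) m with hV
  set W := ⨆ m : Set.Ici c, Module.End.eigenspace (T : H →ₗ[ℝ] H) m with hW
  have hVW : V ⟂ W := hT.isOrtho_iSup_eigenspace
    (Set.disjoint_left.2 fun x hx hx' => not_lt.2 (Set.mem_Ici.1 hx') (Set.mem_Iio.1 hx))
  have htop : (V ⊔ W)ᗮ = ⊥ := by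
    rw [← ContinuousLinearMap.orthogonalComplement_iSup_eigenspaces_eq_bot hc hT]
    congr 1
    refine le_antisymm (sup_le ?_ ?_) (iSup_le fun m => ?_)
    · exact iSup_le fun m => le_iSup (fun m : ℝ => Module.End.eigenspace (T : H →ₗ[ℝ] H) m) m
    · exact iSup_le fun m => le_iSup (fun m : ℝ => Module.End.eigenspace (T : H →ₗ[ℝ] H) m) m
    · rcases lt_or_ge m c with h | h
      · exact le_sup_of_le_left (le_iSup_of_le (⟨m, h⟩ : Set.Iio c) le_rfl)
      · exact le_sup_of_le_right (le_iSup_of_le (⟨m, h⟩ : Set.Ici c) le_rfl)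
  have hmem : u ∈ V.topologicalClosure := by
    -- It suffices that `Vᗮ` lies in the closure of `W`, since `u` is orthogonal to that closure. A
    -- vector of `Vᗮ` minus its projection to the closure of `W` is orthogonal to all eigenvectors,
    -- hence zero.
    rw [← Submodule.orthogonal_orthogonal_eq_closure]
    have hle : W.topologicalClosure ≤ Vᗮ :=
      Submodule.topologicalClosure_minimal _ (Submodule.isOrtho_iff_le.1 hVW.symm)
        (Submodule.isClosed_orthogonal _)
    intro v hv
    have : v ∈ W.topologicalClosure := by
      have hz : v - W.topologicalClosure.starProjection v ∈ (V ⊔ W)ᗮ := by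
        have h1 : v - W.topologicalClosure.starProjection v ∈ W.topologicalClosureᗮ :=
          Submodule.sub_starProjection_mem_orthogonal v
        rw [← Submodule.inf_orthogonal]
        refine ⟨sub_mem hv (hle (Submodule.starProjection_apply_mem _ _)), ?_⟩
        exact Submodule.orthogonal_le W.le_topologicalClosure h1
      rw [htop, Submodule.mem_bot, sub_eq_zero] at hz
      rw [hz]
      exact Submodule.starProjection_apply_mem _ _
    rw [← Submodule.orthogonal_closure] at hu
    exact hu v this
  have hclosed : IsClosed {v : H | inner ℝ (T v) v ≤ c * ‖v‖ ^ 2} :=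
    isClosed_le (by fun_prop) (by fun_prop)
  refine closure_minimal (fun v hv => ?_) hclosed hmem
  exact hT.inner_le_of_mem_iSup_eigenspace (fun m hm => le_of_lt hm) hv

/-- An operator which is arbitrarily small on orthogonal complements of preimages of
finite-dimensional spaces is compact. -/
theorem isCompactOperator_of_forall_exists_finiteDimensional {X : Type*} [NormedAddCommGroup X]
    [InnerProductSpace ℝ X] [CompleteSpace X] [CompleteSpace H] (J : X →L[ℝ] H)
    (h : ∀ ε > 0, ∃ V : Submodule ℝ H, FiniteDimensional ℝ V ∧
      ∀ q : X, J q ∈ Vᗮ → ‖J q‖ ^ 2 ≤ ε * ‖q‖ ^ 2) : IsCompactOperator J := by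
  have hcl := isClosed_setOfPred_isCompactOperator (𝕜₁ := ℝ) (σ₁₂ := RingHom.id ℝ) (M₁ := X)
    (M₂ := H)
  have : J ∈ closure {f : X →L[ℝ] H | IsCompactOperator f} := by
    rw [Metric.mem_closure_iff]
    intro ε hε
    -- The square because the hypothesis bounds squared norms; the half gives a strict inequality
    -- for the operator norm.
    obtain ⟨V, hV, hVq⟩ := h ((ε / 2) ^ 2) (by positivity)
    -- With this `W`, a vector `q ∈ Wᗮ` has `J q ∈ Vᗮ`. Hence `J` is close to the finite-rank
    -- operator `J` composed with the projection to `W`.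
    set W : Submodule ℝ X := V.map (J.adjoint : H →ₗ[ℝ] X)
    have : FiniteDimensional ℝ W := inferInstance
    have : ProperSpace W := FiniteDimensional.proper ℝ W
    refine ⟨J ∘L W.starProjection, ?_, ?_⟩
    · have : IsCompactOperator (W.orthogonalProjectionOnto : X →L[ℝ] W) :=
        isCompactOperator_of_locallyCompactSpace_dom _
      exact this.clm_comp (J ∘L W.subtypeL)
    · rw [dist_eq_norm]
      refine lt_of_le_of_lt (ContinuousLinearMap.opNorm_le_bound _ (by positivity : 0 ≤ ε / 2) ?_)
        (half_lt_self hε)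
      intro q
      have hr : q - W.starProjection q ∈ Wᗮ := Submodule.sub_starProjection_mem_orthogonal q
      have hJ : J (q - W.starProjection q) ∈ Vᗮ := by
        intro v hv
        rw [← ContinuousLinearMap.adjoint_inner_left]
        exact hr _ (Submodule.mem_map_of_mem hv)
      have h1 := hVq _ hJ
      rw [← mul_pow] at h1
      have h2 := le_of_sq_le_sq h1 (by positivity)
      have h3 : ‖q - W.starProjection q‖ ≤ ‖q‖ := by
        rw [← Submodule.starProjection_orthogonal_val]
        exact Submodule.norm_starProjection_apply_le _ _
      calc _ = ‖J (q - W.starProjection q)‖ := by simp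
        _ ≤ ε / 2 * ‖q - W.starProjection q‖ := h2
        _ ≤ _ := by gcongr
  exact hcl.closure_subset this

end Spectral

/-! ### Closed forms with compact embedding and their spectrum. -/

section Forms

variable {H : Type*} [NormedAddCommGroup H] [InnerProductSpace ℝ H]

/-- The graph space of a form: its elements are the pairs `(v, v')`, with the Hilbert norm. -/
def formSpace (D : Submodule ℝ (H × H)) : Submodule ℝ (WithLp 2 (H × H)) :=
  D.comap (WithLp.linearEquiv 2 ℝ (H × H)).toLinearMap

/-- The embedding of the graph space of a form in the Hilbert space. -/
def formEmbedding (D : Submodule ℝ (H × H)) : formSpace D →L[ℝ] H :=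
  (WithLp.fstL 2 ℝ H H) ∘L (formSpace D).subtypeL

/-- The sublevel estimate that characterises forms with compact embedding. -/
def IsCompactForm (D : Submodule ℝ (H × H)) : Prop :=
  ∀ ε > 0, ∃ V : Submodule ℝ H, FiniteDimensional ℝ V ∧
    ∀ p ∈ D, p.1 ∈ Vᗮ → ‖p.1‖ ^ 2 ≤ ε * (‖p.1‖ ^ 2 + ‖p.2‖ ^ 2)

theorem IsCompactForm.mono {D D' : Submodule ℝ (H × H)} (h : IsCompactForm D') (hD : D ≤ D') :
    IsCompactForm D := fun ε hε => by
  obtain ⟨V, hV, hVp⟩ := h ε hε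
  exact ⟨V, hV, fun p hp => hVp p (hD hp)⟩

/-- A closed, densely defined form with compact embedding. -/
structure IsDiscreteForm (D : Submodule ℝ (H × H)) : Prop where
  closed : IsClosed (D : Set (H × H))
  dense : Dense (Prod.fst '' (D : Set (H × H)))
  compact : IsCompactForm D

/-- The element of the graph space given by a pair in the form domain. -/
def formSpace.mk {D : Submodule ℝ (H × H)} (p : H × H) (hp : p ∈ D) : formSpace D :=
  ⟨WithLp.toLp 2 p, hp⟩

variable {D : Submodule ℝ (H × H)}

theorem formSpace.norm_sq (q : formSpace D) :
    ‖q‖ ^ 2 = ‖formEmbedding D q‖ ^ 2 + ‖(q : WithLp 2 (H × H)).snd‖ ^ 2 :=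
  WithLp.prod_norm_sq_eq_of_L2 (q : WithLp 2 (H × H))

theorem formSpace.inner_eq (q r : formSpace D) :
    inner ℝ q r = inner ℝ (formEmbedding D q) (formEmbedding D r) +
      inner ℝ (q : WithLp 2 (H × H)).snd (r : WithLp 2 (H × H)).snd :=
  WithLp.prod_inner_apply (q : WithLp 2 (H × H)) (r : WithLp 2 (H × H))

theorem formSpace.completeSpace [CompleteSpace H] (hD : IsClosed (D : Set (H × H))) :
    CompleteSpace (formSpace D) := by
  have : IsClosed (formSpace D : Set (WithLp 2 (H × H))) :=
    hD.preimage (WithLp.prod_continuous_ofLp 2 H H)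
  exact this.completeSpace_coe

theorem IsDiscreteForm.isCompactOperator [CompleteSpace H] (hD : IsDiscreteForm D) :
    IsCompactOperator (formEmbedding D) := by
  have := formSpace.completeSpace hD.closed
  refine isCompactOperator_of_forall_exists_finiteDimensional _ fun ε hε => ?_
  obtain ⟨V, hV, hVp⟩ := hD.compact ε hε
  refine ⟨V, hV, fun q hq => ?_⟩
  rw [formSpace.norm_sq]
  exact hVp (WithLp.ofLp q.1) q.2 hq

theorem mem_opEigenspace_formOperator {s : ℝ} {u : H} :
    u ∈ opEigenspace (formOperator D) s ↔
      ∃ g, (u, g) ∈ D ∧ ∀ q ∈ D, inner ℝ g q.2 = inner ℝ (s • u) q.1 := Iff.rfl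

/-- Testing with `u` itself gives `‖g‖ ^ 2 = s * ‖u‖ ^ 2`. The range `s ≤ -1` is what has to be
excluded before passing to `1 / (1 + s)`. -/
theorem opEigenspace_eq_bot {s : ℝ} (hs : s ≤ -1) : opEigenspace (formOperator D) s = ⊥ := by
  rw [Submodule.eq_bot_iff]
  intro u hu
  obtain ⟨g, hg, h⟩ := mem_opEigenspace_formOperator.1 hu
  have h1 := h (u, g) hg
  simp only [real_inner_smul_left, real_inner_self_eq_norm_sq] at h1
  have : ‖u‖ ^ 2 ≤ 0 := by nlinarith [sq_nonneg ‖g‖, sq_nonneg ‖u‖]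
  simpa using le_antisymm this (sq_nonneg _)

section Resolvent

variable [CompleteSpace H] [CompleteSpace (formSpace D)]

variable (D) in
/-- The operator `J* J`, where `J` is the embedding of the form domain. -/
def formResolvent : formSpace D →L[ℝ] formSpace D :=
  (formEmbedding D).adjoint ∘L formEmbedding D

theorem formResolvent_inner (q r : formSpace D) :
    inner ℝ (formResolvent D q) r = inner ℝ (formEmbedding D q) (formEmbedding D r) := by
  simp [formResolvent, ContinuousLinearMap.adjoint_inner_left]

theorem formResolvent_isSymmetric :
    (formResolvent D : formSpace D →ₗ[ℝ] formSpace D).IsSymmetric := fun q r => by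
  have h := formResolvent_inner q r
  have h' := formResolvent_inner r q
  rw [real_inner_comm] at h'
  simpa [h, real_inner_comm] using h'.symm

theorem IsDiscreteForm.isCompactOperator_formResolvent (hD : IsDiscreteForm D) :
    IsCompactOperator (formResolvent D) :=
  hD.isCompactOperator.clm_comp (formEmbedding D).adjoint

/-- The eigenvalue equation says that `⟪q, r⟫ = (1 + s) * ⟪J q, J r⟫` in the graph space, and `⟪J q,
J r⟫ = ⟪J* J q, r⟫`. -/
theorem opEigenspace_le_map {s : ℝ} (hs : -1 < s) :
    opEigenspace (formOperator D) s ≤ (Module.End.eigenspace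
      (formResolvent D : formSpace D →ₗ[ℝ] formSpace D) (1 / (1 + s))).map
        (formEmbedding D : formSpace D →ₗ[ℝ] H) := by
  intro u hu
  obtain ⟨g, hg, h⟩ := mem_opEigenspace_formOperator.1 hu
  refine ⟨formSpace.mk (u, g) hg, ?_, rfl⟩
  rw [SetLike.mem_coe, Module.End.mem_eigenspace_iff]
  refine ext_inner_right ℝ fun r => ?_
  have h1 := h (WithLp.ofLp r.1) r.2
  rw [real_inner_smul_left] at h1
  rw [ContinuousLinearMap.coe_coe, formResolvent_inner, real_inner_smul_left, formSpace.inner_eq]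
  change inner ℝ u r.1.fst = 1 / (1 + s) * (inner ℝ u r.1.fst + inner ℝ g r.1.snd)
  have h2 : inner ℝ g r.1.snd = s * inner ℝ u r.1.fst := h1
  rw [h2]
  have : 1 + s ≠ 0 := by linarith
  field_simp

theorem formEmbedding_mem_opEigenspace {m : ℝ} (hm : m ≠ 0) {q : formSpace D}
    (hq : q ∈ Module.End.eigenspace (formResolvent D : formSpace D →ₗ[ℝ] formSpace D) m) :
    formEmbedding D q ∈ opEigenspace (formOperator D) (1 / m - 1) := by
  rw [Module.End.mem_eigenspace_iff] at hq
  refine mem_opEigenspace_formOperator.2 ⟨q.1.snd, q.2, fun r hr => ?_⟩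
  have h1 := formResolvent_inner q (formSpace.mk r hr)
  rw [← ContinuousLinearMap.coe_coe, hq, real_inner_smul_left, formSpace.inner_eq] at h1
  change m * (inner ℝ (formEmbedding D q) r.1 + inner ℝ q.1.snd r.2) =
    inner ℝ (formEmbedding D q) r.1 at h1
  rw [real_inner_smul_left]
  field_simp
  linarith

/-- The kernel of `J* J` is that of `J`, so the eigenvalue `0` of the resolvent contributes no
eigenfunctions of the form operator. -/
theorem formEmbedding_eq_zero {q : formSpace D}
    (hq : q ∈ Module.End.eigenspace (formResolvent D : formSpace D →ₗ[ℝ] formSpace D) 0) :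
    formEmbedding D q = 0 := by
  rw [Module.End.mem_eigenspace_iff] at hq
  have h1 := formResolvent_inner q q
  rw [← ContinuousLinearMap.coe_coe, hq] at h1
  simpa using h1.symm

end Resolvent

/-- The map `s ↦ 1 / (1 + s)` reverses the order on `s > -1`, so the levels up to `t` become the
resolvent eigenvalues from `1 / (1 + t)` upwards. -/
theorem opEigenspaceLE_le_map [CompleteSpace H] [CompleteSpace (formSpace D)] (t : ℝ) :
    opEigenspaceLE (formOperator D) t ≤ (⨆ m : Set.Ici (1 / (1 + t)),
      Module.End.eigenspace (formResolvent D : formSpace D →ₗ[ℝ] formSpace D) (m : ℝ)).map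
        (formEmbedding D : formSpace D →ₗ[ℝ] H) := by
  refine iSup_le fun s => ?_
  rcases le_or_gt (s : ℝ) (-1) with hs | hs
  · rw [opEigenspace_eq_bot hs]
    exact bot_le
  · refine (opEigenspace_le_map hs).trans (Submodule.map_mono ?_)
    have hle : 1 / (1 + t) ≤ 1 / (1 + (s : ℝ)) := by
      have : (s : ℝ) ≤ t := s.2
      gcongr
      linarith
    exact le_iSup_of_le (⟨_, hle⟩ : Set.Ici (1 / (1 + t))) le_rfl

theorem map_le_opEigenspaceLE [CompleteSpace H] [CompleteSpace (formSpace D)] {t : ℝ}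
    (ht : -1 < t) : (⨆ m : Set.Ici (1 / (1 + t)),
      Module.End.eigenspace (formResolvent D : formSpace D →ₗ[ℝ] formSpace D) (m : ℝ)).map
        (formEmbedding D : formSpace D →ₗ[ℝ] H) ≤ opEigenspaceLE (formOperator D) t := by
  rw [Submodule.map_le_iff_le_comap]
  refine iSup_le fun m q hq => ?_
  have h0 : 0 < 1 / (1 + t) := one_div_pos.2 (by linarith)
  have hm : 1 / (1 + t) ≤ (m : ℝ) := m.2
  have hm0 : 0 < (m : ℝ) := h0.trans_le hm
  have hle : 1 / (m : ℝ) - 1 ≤ t := by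
    have := one_div_le_one_div_of_le h0 hm
    rw [one_div_one_div] at this
    linarith
  exact (le_iSup (fun s : Set.Iic t => opEigenspace (formOperator D) (s : ℝ)) ⟨_, hle⟩)
    (formEmbedding_mem_opEigenspace hm0.ne' hq)

/-- The eigenfunctions up to level `t` come from a subspace of the form domain on which the form is
at most `t` times the square of the norm. -/
theorem exists_submodule_opEigenspaceLE [CompleteSpace H] (hD : IsClosed (D : Set (H × H)))
    (t : ℝ) : ∃ W ≤ D, opEigenspaceLE (formOperator D) t ≤ W.map (LinearMap.fst ℝ H H) ∧
      ∀ p ∈ W, ‖p.2‖ ^ 2 ≤ t * ‖p.1‖ ^ 2 := by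
  have := formSpace.completeSpace hD
  rcases le_or_gt t (-1) with ht | ht
  · refine ⟨⊥, bot_le, ?_, by simp +contextual⟩
    refine iSup_le fun s => ?_
    rw [opEigenspace_eq_bot (le_trans s.2 ht)]
    exact bot_le
  · set V := ⨆ m : Set.Ici (1 / (1 + t)),
      Module.End.eigenspace (formResolvent D : formSpace D →ₗ[ℝ] formSpace D) (m : ℝ) with hV
    refine ⟨V.map ((WithLp.linearEquiv 2 ℝ (H × H)).toLinearMap ∘ₗ (formSpace D).subtype),
      ?_, ?_, ?_⟩
    · rintro _ ⟨q, _, rfl⟩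
      exact q.2
    · intro u hu
      obtain ⟨q, hq, rfl⟩ := opEigenspaceLE_le_map t hu
      exact ⟨WithLp.ofLp q.1, ⟨q, hq, rfl⟩, rfl⟩
    · rintro _ ⟨q, hq, rfl⟩
      have h := LinearMap.IsSymmetric.le_inner_of_mem_iSup_eigenspace
        (formResolvent_isSymmetric (D := D)) (I := Set.Ici (1 / (1 + t))) (c := 1 / (1 + t))
        (fun m hm => Set.mem_Ici.1 hm) (u := q) hq
      rw [ContinuousLinearMap.coe_coe, formResolvent_inner, real_inner_self_eq_norm_sq,
        formSpace.norm_sq] at h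
      change ‖q.1.snd‖ ^ 2 ≤ t * ‖formEmbedding D q‖ ^ 2
      have h0 : 0 < 1 + t := by linarith
      rw [one_div, inv_mul_le_iff₀ h0] at h
      linarith

/-- On the orthogonal complement of the eigenfunctions up to level `t`, the form is at least `t`
times the square of the norm. -/
theorem IsDiscreteForm.le_of_mem_orthogonal [CompleteSpace H] (hD : IsDiscreteForm D) {t : ℝ}
    (ht : -1 < t) {p : H × H} (hp : p ∈ D) (h : p.1 ∈ (opEigenspaceLE (formOperator D) t)ᗮ) :
    t * ‖p.1‖ ^ 2 ≤ ‖p.2‖ ^ 2 := by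
  have := formSpace.completeSpace hD.closed
  have h0 : 0 < 1 + t := by linarith
  have key := ContinuousLinearMap.inner_le_of_mem_orthogonal_iSup_eigenspace
    (T := formResolvent D) (c := 1 / (1 + t)) (u := formSpace.mk p hp)
    hD.isCompactOperator_formResolvent formResolvent_isSymmetric ?_
  · rw [formResolvent_inner, real_inner_self_eq_norm_sq, formSpace.norm_sq] at key
    change ‖p.1‖ ^ 2 ≤ 1 / (1 + t) * (‖p.1‖ ^ 2 + ‖p.2‖ ^ 2) at key
    rw [one_div, le_inv_mul_iff₀ h0] at key
    linarith
  -- For a resolvent eigenvector `r` with eigenvalue `m > 0`, `m * ⟪r, p⟫ = ⟪J r, J p⟫`, and this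
  -- vanishes by hypothesis because `J r` is an eigenfunction up to level `t`.
  · rw [← Submodule.iInf_orthogonal, Submodule.mem_iInf]
    intro m r hr
    have hm : 0 < (m : ℝ) := (one_div_pos.2 h0).trans_le m.2
    have h1 : formEmbedding D r ∈ opEigenspaceLE (formOperator D) t :=
      map_le_opEigenspaceLE ht ⟨r, le_iSup (fun m : Set.Ici (1 / (1 + t)) =>
        Module.End.eigenspace (formResolvent D : formSpace D →ₗ[ℝ] formSpace D) (m : ℝ)) m hr, rfl⟩
    have h2 := formResolvent_inner r (formSpace.mk p hp)
    rw [Module.End.mem_eigenspace_iff] at hr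
    rw [← ContinuousLinearMap.coe_coe, hr, real_inner_smul_left] at h2
    have h3 : inner ℝ (formEmbedding D r) (formEmbedding D (formSpace.mk p hp)) = 0 := h _ h1
    rw [h3] at h2
    exact (mul_eq_zero.1 h2).resolve_left hm.ne'

/-- The projection to the finite-dimensional `V` of the compactness estimate is injective on these
eigenfunctions: on its kernel that estimate and the form bound `t` give `‖u‖ ^ 2 ≤ ‖u‖ ^ 2 / 2`.
This explains the constant `1 / (2 * (1 + |t|))`. -/
theorem IsDiscreteForm.finiteDimensional_opEigenspaceLE [CompleteSpace H] (hD : IsDiscreteForm D)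
    (t : ℝ) : FiniteDimensional ℝ (opEigenspaceLE (formOperator D) t) := by
  obtain ⟨W, hWD, hW, hWt⟩ := exists_submodule_opEigenspaceLE hD.closed t
  obtain ⟨V, hV, hVp⟩ := hD.compact (1 / (2 * (1 + |t|))) (by positivity)
  let F : opEigenspaceLE (formOperator D) t →ₗ[ℝ] V :=
    (V.orthogonalProjectionOnto : H →ₗ[ℝ] V) ∘ₗ Submodule.subtype _
  refine FiniteDimensional.of_injective F ?_
  rw [← LinearMap.ker_eq_bot, Submodule.eq_bot_iff]
  intro u hu
  obtain ⟨p, hp, hpu⟩ := hW u.2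
  change p.1 = (u : H) at hpu
  have huV : p.1 ∈ Vᗮ := by
    rw [hpu]
    exact Submodule.orthogonalProjectionOnto_eq_zero_iff.1 hu
  have h1 := hVp p (hWD hp) huV
  have h2 := hWt p hp
  have h3 : 0 < 2 * (1 + |t|) := by positivity
  rw [one_div, le_inv_mul_iff₀ h3] at h1
  have h4 := mul_le_mul_of_nonneg_right (le_abs_self t) (sq_nonneg ‖p.1‖)
  have h5 : 0 ≤ |t| * ‖p.1‖ ^ 2 := by positivity
  have h6 : ‖p.1‖ ^ 2 ≤ 0 := by nlinarith
  have h7 : p.1 = 0 := by simpa using le_antisymm h6 (sq_nonneg _)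
  exact Subtype.ext (by rw [← hpu, h7]; rfl)

/-- Resolvent eigenvectors are total in the graph space; `J` is continuous with dense range and
sends them to eigenfunctions or to zero. -/
theorem IsDiscreteForm.hasPurelyDiscreteSpectrum [CompleteSpace H] (hD : IsDiscreteForm D) :
    HasPurelyDiscreteSpectrum (formOperator D) := by
  refine ⟨hD.finiteDimensional_opEigenspaceLE, ?_⟩
  have := formSpace.completeSpace hD.closed
  have htop : (⨆ m : ℝ, Module.End.eigenspace
      (formResolvent D : formSpace D →ₗ[ℝ] formSpace D) m).topologicalClosure = ⊤ := by
    rw [Submodule.topologicalClosure_eq_top_iff]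
    exact ContinuousLinearMap.orthogonalComplement_iSup_eigenspaces_eq_bot
      hD.isCompactOperator_formResolvent formResolvent_isSymmetric
  have hle : (⨆ m : ℝ, Module.End.eigenspace (formResolvent D : formSpace D →ₗ[ℝ] formSpace D) m) ≤
      (⨆ s : ℝ, opEigenspace (formOperator D) s).comap
        (formEmbedding D : formSpace D →ₗ[ℝ] H) := by
    refine iSup_le fun m q hq => ?_
    rcases eq_or_ne m 0 with rfl | hm
    · rw [Submodule.mem_comap, ContinuousLinearMap.coe_coe, formEmbedding_eq_zero hq]
      exact zero_mem _
    · exact le_iSup (fun s : ℝ => opEigenspace (formOperator D) s) _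
        (formEmbedding_mem_opEigenspace hm hq)
  rw [Submodule.topologicalClosure_eq_top_iff, ← Submodule.orthogonal_closure,
    ← Submodule.topologicalClosure_eq_top_iff, eq_top_iff]
  rintro u -
  refine closure_mono ?_ (hD.dense u)
  rintro _ ⟨p, hp, rfl⟩
  have hmem : formSpace.mk p hp ∈ (⨆ m : ℝ, Module.End.eigenspace
      (formResolvent D : formSpace D →ₗ[ℝ] formSpace D) m).topologicalClosure := by
    rw [htop]
    trivial
  exact map_mem_closure (f := formEmbedding D) (formEmbedding D).continuous hmem
    fun q hq => hle hq

end Forms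

/-! ### The min-max principle and comparison of eigenvalues. -/

section MinMax

variable {H : Type*} [NormedAddCommGroup H] [InnerProductSpace ℝ H]
  {H' : Type*} [NormedAddCommGroup H'] [InnerProductSpace ℝ H']
  {D D₀ : Submodule ℝ (H × H)} {D' : Submodule ℝ (H' × H')} {k : ℕ} {t : ℝ}

/-- On the span of a finite family of pairs `(v, v')`, the form is less than `t` times the square of
the norm. -/
def IsFormBelow (t : ℝ) (p : Fin k → H × H) : Prop :=
  ∀ c : Fin k → ℝ, c ≠ 0 → ‖(∑ i, c i • p i).2‖ ^ 2 < t * ‖(∑ i, c i • p i).1‖ ^ 2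

theorem IsFormBelow.pos (hk : 1 ≤ k) {p : Fin k → H × H} (hp : IsFormBelow t p) : 0 < t := by
  have h := hp (fun _ => 1) fun h => one_ne_zero (congrFun h ⟨0, hk⟩)
  by_contra! ht
  nlinarith [sq_nonneg ‖(∑ i, (1 : ℝ) • p i).2‖, sq_nonneg ‖(∑ i, (1 : ℝ) • p i).1‖]

/-- Min-max principle: test functions bound eigenvalues from above. -/
theorem IsDiscreteForm.kthEigenvalue_le [CompleteSpace H] (hD : IsDiscreteForm D) (hk : 1 ≤ k)
    {p : Fin k → H × H} (hpD : ∀ i, p i ∈ D) (hp : IsFormBelow t p) :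
    kthEigenvalue (formOperator D) k ≤ t := by
  have ht := hp.pos hk
  have := hD.finiteDimensional_opEigenspaceLE t
  refine iInf₂_le_of_le t ?_ le_rfl
  by_contra! hlt
  rw [← Module.finrank_eq_rank, Nat.cast_lt] at hlt
  set V := opEigenspaceLE (formOperator D) t
  -- With fewer than `k` eigenfunctions up to level `t`, some nontrivial combination of the test
  -- functions is orthogonal to all of them, so its form is at least `t` times its squared norm.
  let F : (Fin k → ℝ) →ₗ[ℝ] V := (V.orthogonalProjectionOnto : H →ₗ[ℝ] V) ∘ₗ
    LinearMap.fst ℝ H H ∘ₗ Fintype.linearCombination ℝ p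
  obtain ⟨c, hc, hc0⟩ := Submodule.exists_mem_ne_zero_of_ne_bot
    (LinearMap.ker_ne_bot_of_finrank_lt (f := F) (by simpa using hlt))
  have h1 := hp c hc0
  have h2 := hD.le_of_mem_orthogonal (by linarith)
    (sum_mem fun i _ => D.smul_mem (c i) (hpD i) : ∑ i, c i • p i ∈ D)
    (Submodule.orthogonalProjectionOnto_eq_zero_iff.1 hc)
  exact absurd h1 (not_lt.2 h2)

/-- Min-max principle: above an eigenvalue there are test functions. -/
theorem IsDiscreteForm.exists_isFormBelow [CompleteSpace H] (hD : IsDiscreteForm D)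
    (h : kthEigenvalue (formOperator D) k < t) :
    ∃ p : Fin k → H × H, (∀ i, p i ∈ D) ∧ IsFormBelow t p := by
  simp only [kthEigenvalue, iInf_lt_iff] at h
  obtain ⟨s, hs, hst⟩ := h
  rw [EReal.coe_lt_coe_iff] at hst
  have := hD.finiteDimensional_opEigenspaceLE s
  rw [← Module.finrank_eq_rank, Nat.cast_le] at hs
  obtain ⟨W, hWD, hW, hWs⟩ := exists_submodule_opEigenspaceLE hD.closed s
  let b := Module.finBasis ℝ (opEigenspaceLE (formOperator D) s)
  choose q hq hqb using fun i : Fin k => hW (b (Fin.castLE hs i)).2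
  -- The form is at most `s` times the squared norm; since `s < t`, strictness only needs the first
  -- component to be nonzero, which is linear independence.
  refine ⟨q, fun i => hWD (hq i), fun c hc => ?_⟩
  have hli : LinearIndependent ℝ fun i : Fin k => (b (Fin.castLE hs i) : H) :=
    (b.linearIndependent.comp _ (Fin.castLE_injective hs)).map' (Submodule.subtype _)
      (Submodule.ker_subtype _)
  have hfst : (∑ i, c i • q i).1 = ∑ i, c i • (b (Fin.castLE hs i) : H) := by
    rw [Prod.fst_sum]
    exact Finset.sum_congr rfl fun i _ => by rw [← hqb i]; rfl
  have hne : (∑ i, c i • q i).1 ≠ 0 := fun h0 => hc <| funext <|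
    Fintype.linearIndependent_iff.1 hli c (hfst ▸ h0)
  refine (hWs _ (sum_mem fun i _ => W.smul_mem (c i) (hq i))).trans_lt ?_
  exact mul_lt_mul_of_pos_right hst (by positivity)

/-- Both sides are homogeneous of degree two in `c`, so it is enough to look at the compact unit
sphere, where a strict inequality survives small perturbations of the family. -/
theorem isOpen_isFormBelow (t : ℝ) : IsOpen {p : Fin k → H × H | IsFormBelow t p} := by
  have hS : IsCompact (Metric.sphere (0 : Fin k → ℝ) 1) := isCompact_sphere _ _
  have hcont : Continuous fun z : (Fin k → H × H) × (Fin k → ℝ) =>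
      t * ‖(∑ i, z.2 i • z.1 i).1‖ ^ 2 - ‖(∑ i, z.2 i • z.1 i).2‖ ^ 2 := by fun_prop
  rw [isOpen_iff_eventually]
  intro p hp
  have key : ∀ᶠ p' in 𝓝 p, ∀ c ∈ Metric.sphere (0 : Fin k → ℝ) 1,
      0 < t * ‖(∑ i, c i • p' i).1‖ ^ 2 - ‖(∑ i, c i • p' i).2‖ ^ 2 := by
    refine hS.eventually_forall_of_forall_eventually fun c hc => ?_
    have hc0 : c ≠ 0 := fun h => by simp [h] at hc
    exact hcont.continuousAt.eventually (lt_mem_nhds (sub_pos.2 (hp c hc0)))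
  filter_upwards [key] with p' hp' c hc
  have hn : 0 < ‖c‖ := norm_pos_iff.2 hc
  have h := hp' (‖c‖⁻¹ • c) (by simp [norm_smul, hn.ne'])
  simp only [Pi.smul_apply, smul_eq_mul, mul_smul, ← Finset.smul_sum, Prod.smul_fst,
    Prod.smul_snd, norm_smul, mul_pow] at h
  have h2 : 0 < ‖(‖c‖⁻¹ : ℝ)‖ ^ 2 := pow_pos (norm_pos_iff.2 (inv_ne_zero hn.ne')) 2
  by_contra! hle
  nlinarith

/-- Being below `t` is an open condition, so test families can be moved into a core. -/
theorem IsDiscreteForm.exists_isFormBelow_of_le_closure [CompleteSpace H] (hD : IsDiscreteForm D)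
    (hD₀ : D ≤ D₀.topologicalClosure) (h : kthEigenvalue (formOperator D) k < t) :
    ∃ p : Fin k → H × H, (∀ i, p i ∈ D₀) ∧ IsFormBelow t p := by
  obtain ⟨p, hpD, hp⟩ := hD.exists_isFormBelow h
  have hcl : p ∈ closure (Set.univ.pi fun _ : Fin k => (D₀ : Set (H × H))) := by
    rw [closure_pi_set]
    exact fun i _ => hD₀ (hpD i)
  obtain ⟨q, hq, hqD⟩ := mem_closure_iff.1 hcl _ (isOpen_isFormBelow t) hp
  exact ⟨q, fun i => hqD i trivial, hq⟩

/-- Comparison of eigenvalues by extension of the elements of the form domain. -/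
theorem IsDiscreteForm.kthEigenvalue_le_kthEigenvalue [CompleteSpace H] [CompleteSpace H']
    (hD : IsDiscreteForm D) (hD' : IsDiscreteForm D') (hk : 1 ≤ k) (S : H →ₗᵢ[ℝ] H')
    (R : H' →L[ℝ] H) (hR : ∀ u, ‖R u‖ ≤ ‖u‖)
    (hSR : ∀ p ∈ D, ∃ p' ∈ D', p'.2 = S p.2 ∧ R p'.1 = p.1) :
    kthEigenvalue (formOperator D') k ≤ kthEigenvalue (formOperator D) k := by
  refine EReal.le_of_forall_lt_iff_le.1 fun t ht => ?_
  obtain ⟨p, hpD, hp⟩ := hD.exists_isFormBelow ht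
  have ht0 := hp.pos hk
  choose q hqD' hqS hqR using fun i => hSR (p i) (hpD i)
  refine hD'.kthEigenvalue_le hk hqD' fun c hc => ?_
  have h1 : (∑ i, c i • q i).2 = S (∑ i, c i • p i).2 := by
    simp [Prod.snd_sum, map_sum, hqS]
  have h2 : R (∑ i, c i • q i).1 = (∑ i, c i • p i).1 := by
    simp [Prod.fst_sum, map_sum, hqR]
  -- The energy is unchanged, while the norm of the first component can only grow because `R` is a
  -- contraction; as `0 < t`, the inequality persists.
  rw [h1, S.norm_map]
  refine (hp c hc).trans_le ?_
  rw [← h2]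
  gcongr
  exact hR _

/-- Convergence from above of eigenvalues by restriction of the elements of a core. -/
theorem IsDiscreteForm.eventually_kthEigenvalue_le [CompleteSpace H] (hD : IsDiscreteForm D)
    (hD₀ : D ≤ D₀.topologicalClosure) (hk : 1 ≤ k)
    {K : ℕ → Type*} [∀ n, NormedAddCommGroup (K n)] [∀ n, InnerProductSpace ℝ (K n)]
    [∀ n, CompleteSpace (K n)] {Q : ∀ n, Submodule ℝ (K n × K n)}
    (hQ : ∀ n, IsDiscreteForm (Q n)) (S : ∀ n, K n →ₗᵢ[ℝ] H) (R : ∀ n, H →L[ℝ] K n)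
    (hSR : ∀ u, Tendsto (fun n => S n (R n u)) atTop (𝓝 u))
    (hmem : ∀ p ∈ D₀, ∀ᶠ n in atTop, (R n p.1, R n p.2) ∈ Q n)
    (ht : kthEigenvalue (formOperator D) k < t) :
    ∀ᶠ n in atTop, kthEigenvalue (formOperator (Q n)) k ≤ t := by
  obtain ⟨p, hpD, hp⟩ := hD.exists_isFormBelow_of_le_closure hD₀ ht
  have hlim : Tendsto (fun n (i : Fin k) => (S n (R n (p i).1), S n (R n (p i).2))) atTop (𝓝 p) :=
    tendsto_pi_nhds.2 fun i => (hSR _).prodMk_nhds (hSR _)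
  filter_upwards [hlim.eventually ((isOpen_isFormBelow t).mem_nhds hp),
    eventually_all.2 fun i => hmem _ (hpD i)] with n hn hmem
  refine (hQ n).kthEigenvalue_le hk hmem fun c hc => ?_
  have h := hn c hc
  have h1 : (∑ i, c i • (S n (R n (p i).1), S n (R n (p i).2))).1 =
      S n (∑ i, c i • (R n (p i).1, R n (p i).2)).1 := by
    simp [Prod.fst_sum, map_sum]
  have h2 : (∑ i, c i • (S n (R n (p i).1), S n (R n (p i).2))).2 =
      S n (∑ i, c i • (R n (p i).1, R n (p i).2)).2 := by
    simp [Prod.snd_sum, map_sum]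
  rwa [h1, h2, (S n).norm_map, (S n).norm_map] at h

end MinMax

/-! ### Restriction and extension of square summable families. -/

section Lp

variable {ι : Type*} {F : ι → Type*} [∀ i, NormedAddCommGroup (F i)]

theorem memℓp_two_iff {f : ∀ i, F i} : Memℓp f 2 ↔ Summable fun i => ‖f i‖ ^ 2 := by
  rw [memℓp_gen_iff (by simp)]
  simp

theorem lp.hasSum_norm_sq (f : lp F 2) : HasSum (fun i => ‖f i‖ ^ 2) (‖f‖ ^ 2) := by
  simpa using lp.hasSum_norm (p := 2) (by simp) f

variable (S : Set ι)

open Classical in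
/-- Extension by zero of families indexed by a subset. -/
def piExtend (u : ∀ i : S, F i) (i : ι) : F i := if h : i ∈ S then u ⟨i, h⟩ else 0

variable {S}

theorem piExtend_of_mem (u : ∀ i : S, F i) {i : ι} (h : i ∈ S) : piExtend S u i = u ⟨i, h⟩ :=
  dif_pos h

theorem piExtend_of_notMem (u : ∀ i : S, F i) {i : ι} (h : i ∉ S) : piExtend S u i = 0 :=
  dif_neg h

theorem hasSum_norm_sq_piExtend (u : lp (fun i : S => F i) 2) :
    HasSum (fun i => ‖piExtend S (fun j => u j) i‖ ^ 2) (‖u‖ ^ 2) := by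
  rw [← hasSum_subtype_iff_of_support_subset (s := S)]
  · convert lp.hasSum_norm_sq u using 2 with i
    simp [piExtend_of_mem]
  · intro i hi
    by_contra h
    simp [piExtend_of_notMem _ h] at hi

variable [∀ i, NormedSpace ℝ (F i)] (S)

/-- Restriction of a square summable family to a subset of the indices, as a linear map. -/
def lpRestrictLinear : lp F 2 →ₗ[ℝ] lp (fun i : S => F i) 2 where
  toFun u := ⟨fun i => u i, memℓp_two_iff.2 ((lp.hasSum_norm_sq u).summable.subtype S)⟩
  map_add' _ _ := rfl
  map_smul' _ _ := rfl

theorem norm_lpRestrictLinear_le (u : lp F 2) : ‖lpRestrictLinear S u‖ ≤ 1 * ‖u‖ := by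
  rw [one_mul]
  refine le_of_sq_le_sq ?_ (norm_nonneg _)
  rw [← (lp.hasSum_norm_sq u).tsum_eq, ← (lp.hasSum_norm_sq (lpRestrictLinear S u)).tsum_eq]
  exact Summable.tsum_subtype_le (fun i => ‖u i‖ ^ 2) S (fun _ => sq_nonneg _)
    (lp.hasSum_norm_sq u).summable

/-- Restriction of a square summable family to a subset of the indices. -/
def lpRestrict : lp F 2 →L[ℝ] lp (fun i : S => F i) 2 :=
  (lpRestrictLinear S).mkContinuous 1 (norm_lpRestrictLinear_le S)

theorem lpRestrict_apply (u : lp F 2) (i : S) : lpRestrict S u i = u i := rfl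

theorem norm_lpRestrict_le (u : lp F 2) : ‖lpRestrict S u‖ ≤ ‖u‖ :=
  (norm_lpRestrictLinear_le S u).trans (one_mul _).le

/-- Extension by zero of a square summable family. -/
def lpExtend : lp (fun i : S => F i) 2 →ₗᵢ[ℝ] lp F 2 where
  toFun u := ⟨piExtend S (fun j => u j), memℓp_two_iff.2 (hasSum_norm_sq_piExtend u).summable⟩
  map_add' u v := by
    ext i : 2
    by_cases h : i ∈ S
    · simp only [lp.coeFn_add, Pi.add_apply, piExtend_of_mem _ h]
    · simp only [lp.coeFn_add, Pi.add_apply, piExtend_of_notMem _ h, add_zero]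
  map_smul' c u := by
    ext i : 2
    by_cases h : i ∈ S
    · simp only [lp.coeFn_smul, Pi.smul_apply, piExtend_of_mem _ h,
        RingHom.id_apply]
    · simp only [lp.coeFn_smul, Pi.smul_apply, piExtend_of_notMem _ h,
        RingHom.id_apply, smul_zero]
  norm_map' u := by
    rw [← sq_eq_sq₀ (norm_nonneg _) (norm_nonneg _)]
    exact (lp.hasSum_norm_sq _).unique (hasSum_norm_sq_piExtend u)

variable {S}

theorem lpExtend_of_mem (u : lp (fun i : S => F i) 2) {i : ι} (h : i ∈ S) :
    lpExtend S u i = u ⟨i, h⟩ :=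
  piExtend_of_mem (fun j => u j) h

theorem lpExtend_of_notMem (u : lp (fun i : S => F i) 2) {i : ι} (h : i ∉ S) :
    lpExtend S u i = 0 :=
  piExtend_of_notMem (fun j => u j) h

theorem tendsto_lpExtend_lpRestrict {K : ℕ → Set ι} (hK : Monotone K) (hex : ∀ i, ∃ n, i ∈ K n)
    (u : lp F 2) : Tendsto (fun n => lpExtend (K n) (lpRestrict (K n) u)) atTop (𝓝 u) := by
  rw [tendsto_iff_norm_sub_tendsto_zero]
  have key : Tendsto (fun n => ‖lpExtend (K n) (lpRestrict (K n) u) - u‖ ^ 2) atTop (𝓝 0) := by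
    simp_rw [← (lp.hasSum_norm_sq _).tsum_eq]
    rw [← tsum_zero (α := ℝ) (β := ι)]
    -- Each term is eventually zero, and all are dominated by `‖u i‖ ^ 2`.
    refine tendsto_tsum_of_dominated_convergence (lp.hasSum_norm_sq u).summable
      (fun i => ?_) (Eventually.of_forall fun n i => ?_)
    · obtain ⟨N, hN⟩ := hex i
      refine tendsto_const_nhds.congr' ?_
      filter_upwards [eventually_ge_atTop N] with n hn
      rw [lp.coeFn_sub, Pi.sub_apply, lpExtend_of_mem _ (hK hn hN), lpRestrict_apply, sub_self,
        norm_zero, zero_pow two_ne_zero]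
    · rw [lp.coeFn_sub, Pi.sub_apply]
      by_cases h : i ∈ K n
      · rw [lpExtend_of_mem _ h, lpRestrict_apply, sub_self]
        simp
      · rw [lpExtend_of_notMem _ h]
        simp
  have := key.sqrt
  simpa using this

end Lp

/-! ### Topology of the glued space and of its subgraphs. -/

namespace MetricGraph

variable {E : Type*} (G : MetricGraph E)

/-- The coordinate of an endpoint of an edge. -/
def endCoord (a : E × Bool) : ℝ := if a.2 then G.len a.1 else 0

theorem endCoord_mem (a : E × Bool) : G.endCoord a ∈ Set.Icc 0 (G.len a.1) := by
  have := (G.len_pos a.1).le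
  unfold endCoord
  split_ifs <;> simp [this]

theorem coe_endpoint_snd (a : E × Bool) : ((G.endpoint a).2 : ℝ) = G.endCoord a := by
  unfold endpoint endCoord
  dsimp only
  split_ifs <;> rfl

theorem pt_of_mem {e : E} {x : ℝ} (hx : x ∈ Set.Icc 0 (G.len e)) :
    G.pt e x = Quot.mk G.Glue ⟨e, ⟨x, hx⟩⟩ := by
  rw [pt, Set.projIcc_of_mem _ hx]

theorem mk_endpoint (a : E × Bool) : Quot.mk G.Glue (G.endpoint a) = G.pt a.1 (G.endCoord a) := by
  rw [G.pt_of_mem (G.endCoord_mem a)]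
  congr 1
  exact Sigma.ext rfl (heq_of_eq (Subtype.ext (G.coe_endpoint_snd a)))

theorem exists_pt (P : G.Space) : ∃ e, ∃ x ∈ Set.Icc 0 (G.len e), G.pt e x = P := by
  obtain ⟨⟨e, x, hx⟩, rfl⟩ := Quot.exists_rep P
  exact ⟨e, x, hx, G.pt_of_mem hx⟩

theorem pt_endCoord_eq {a b : E × Bool} (h : G.rel a b) :
    G.pt a.1 (G.endCoord a) = G.pt b.1 (G.endCoord b) := by
  rw [← mk_endpoint, ← mk_endpoint]
  exact Quot.sound ⟨a, b, h, rfl, rfl⟩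

theorem endpoint_injective : Function.Injective G.endpoint := by
  rintro ⟨e, b⟩ ⟨e', b'⟩ h
  obtain rfl : e = e' := congrArg Sigma.fst h
  have h2 : G.endCoord (e, b) = G.endCoord (e, b') := by
    rw [← coe_endpoint_snd, ← coe_endpoint_snd, h]
  have := (G.len_pos e).ne
  cases b <;> cases b' <;> simp_all [endCoord]

/-- The equivalence relation generated by gluing adds only the diagonal: `endpoint` is injective and
`rel` is already an equivalence, so chains of gluings collapse to one. -/
theorem mk_eq_mk_iff {p q : G.Edges} :
    (Quot.mk G.Glue p = Quot.mk G.Glue q) ↔ p = q ∨ G.Glue p q := by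
  have key : ∀ {p q}, Relation.EqvGen G.Glue p q → p = q ∨ G.Glue p q := fun h => by
    induction h with
    | rel x y h => exact Or.inr h
    | refl x => exact Or.inl rfl
    | symm x y h ih =>
      rcases ih with rfl | ⟨a, b, hab, rfl, rfl⟩
      · exact Or.inl rfl
      · exact Or.inr ⟨b, a, G.rel.symm hab, rfl, rfl⟩
    | trans x y z h₁ h₂ ih₁ ih₂ =>
      rcases ih₁ with rfl | ⟨a, b, hab, rfl, rfl⟩
      · exact ih₂
      · rcases ih₂ with rfl | ⟨b', c, hbc, hb, rfl⟩
        · exact Or.inr ⟨a, b, hab, rfl, rfl⟩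
        · obtain rfl := G.endpoint_injective hb
          exact Or.inr ⟨a, c, G.rel.trans hab hbc, rfl, rfl⟩
  refine ⟨fun h => key (Quot.eqvGen_exact h), fun h => ?_⟩
  rcases h with rfl | h
  · rfl
  · exact Quot.sound h

theorem pt_eq_pt_iff {e e' : E} {x x' : ℝ} (hx : x ∈ Set.Icc 0 (G.len e))
    (hx' : x' ∈ Set.Icc 0 (G.len e')) : G.pt e x = G.pt e' x' ↔ (e = e' ∧ x = x') ∨
      ∃ a b, G.rel a b ∧ a.1 = e ∧ G.endCoord a = x ∧ b.1 = e' ∧ G.endCoord b = x' := by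
  rw [G.pt_of_mem hx, G.pt_of_mem hx']
  refine G.mk_eq_mk_iff.trans (or_congr ⟨fun h => ?_, ?_⟩ ⟨?_, ?_⟩)
  · have he : e = e' := congrArg Sigma.fst h
    subst he
    exact ⟨rfl, congrArg Subtype.val (eq_of_heq (Sigma.ext_iff.1 h).2)⟩
  · rintro ⟨rfl, rfl⟩
    rfl
  · rintro ⟨a, b, hab, ha, hb⟩
    refine ⟨a, b, hab, (congrArg Sigma.fst ha).symm, ?_, (congrArg Sigma.fst hb).symm, ?_⟩
    · rw [← coe_endpoint_snd, ← ha]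
    · rw [← coe_endpoint_snd, ← hb]
  · rintro ⟨a, b, hab, rfl, rfl, rfl, rfl⟩
    exact ⟨a, b, hab, Sigma.ext rfl (heq_of_eq (Subtype.ext (G.coe_endpoint_snd a).symm)),
      Sigma.ext rfl (heq_of_eq (Subtype.ext (G.coe_endpoint_snd b).symm))⟩

theorem endCoord_notMem_Ioo (a : E × Bool) : G.endCoord a ∉ Set.Ioo 0 (G.len a.1) := by
  unfold endCoord
  split_ifs <;> simp

/-- Interior points of edges are not glued to anything. -/
theorem pt_eq_pt_of_mem_Ioo {e e' : E} {x x' : ℝ} (hx : x ∈ Set.Ioo 0 (G.len e))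
    (hx' : x' ∈ Set.Icc 0 (G.len e')) (h : G.pt e x = G.pt e' x') : e = e' ∧ x = x' := by
  rcases (G.pt_eq_pt_iff (Set.Ioo_subset_Icc_self hx) hx').1 h with h | ⟨a, b, -, rfl, rfl, -⟩
  · exact h
  · exact absurd hx (G.endCoord_notMem_Ioo a)

theorem continuous_pt (e : E) : Continuous (G.pt e) :=
  (continuous_quot_mk.comp continuous_sigmaMk).comp continuous_projIcc

theorem continuous_of_edges {Y : Type*} [TopologicalSpace Y] {f : G.Space → Y}
    (hf : ∀ e, ContinuousOn (fun x => f (G.pt e x)) (Set.Icc 0 (G.len e))) : Continuous f := by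
  refine continuous_coinduced_dom.2 (continuous_sigma fun e => ?_)
  refine (continuousOn_iff_continuous_domRestrict.1 (hf e)).congr fun x => ?_
  simp only [Set.domRestrict_apply, G.pt_of_mem x.2]
  rfl

/-- Functions on the graph are given by functions on the edges that agree at glued endpoints. -/
theorem exists_fun {Y : Type*} (φ : E → ℝ → Y)
    (h : ∀ a b, G.rel a b → φ a.1 (G.endCoord a) = φ b.1 (G.endCoord b)) :
    ∃ f : G.Space → Y, ∀ e, ∀ x ∈ Set.Icc 0 (G.len e), f (G.pt e x) = φ e x := by
  refine ⟨Quot.lift (fun p => φ p.1 p.2) ?_, fun e x hx => by rw [G.pt_of_mem hx]⟩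
  rintro _ _ ⟨a, b, hab, rfl, rfl⟩
  rw [coe_endpoint_snd, coe_endpoint_snd]
  exact h a b hab

theorem continuous_incl (S : Set E) : Continuous (G.incl S) :=
  (G.subgraph S).continuous_of_edges fun e => (G.continuous_pt e).continuousOn

theorem mem_range_incl {S : Set E} {P : G.Space} :
    P ∈ Set.range (G.incl S) ↔ ∃ e ∈ S, ∃ x ∈ Set.Icc 0 (G.len e), G.pt e x = P := by
  constructor
  · rintro ⟨Q, rfl⟩
    obtain ⟨e, x, hx, rfl⟩ := (G.subgraph S).exists_pt Q
    exact ⟨e, e.2, x, hx, rfl⟩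
  · rintro ⟨e, he, x, hx, rfl⟩
    exact ⟨(G.subgraph S).pt ⟨e, he⟩ x, rfl⟩

theorem pt_mem_range_incl {S : Set E} {e : E} (he : e ∈ S) (x : ℝ) :
    G.pt e x ∈ Set.range (G.incl S) :=
  ⟨(G.subgraph S).pt ⟨e, he⟩ x, rfl⟩

theorem pt_notMem_range_incl {S : Set E} {e : E} (he : e ∉ S) {x : ℝ}
    (hx : x ∈ Set.Ioo 0 (G.len e)) : G.pt e x ∉ Set.range (G.incl S) := by
  rw [mem_range_incl]
  rintro ⟨e', he', x', hx', h⟩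
  exact he ((G.pt_eq_pt_of_mem_Ioo hx hx' h.symm).1 ▸ he')

/-- Subgraphs are closed. -/
theorem isClosed_range_incl (S : Set E) : IsClosed (Set.range (G.incl S)) := by
  refine isClosed_coinduced.2 (isClosed_sigma_iff.2 fun e => ?_)
  by_cases he : e ∈ S
  · convert isClosed_univ
    refine Set.eq_univ_of_forall fun x => ?_
    have := G.pt_mem_range_incl he x
    rwa [G.pt_of_mem x.2] at this
  -- On an edge outside the subgraph only the two endpoints can belong to it.
  · refine Set.Finite.isClosed (Set.Finite.preimage Subtype.val_injective.injOn
      (Set.toFinite {0, G.len e}) |>.subset fun x hx => ?_)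
    by_contra h
    have hx' : (x : ℝ) ∈ Set.Ioo 0 (G.len e) := by
      simp only [Set.mem_preimage, Set.mem_insert_iff, Set.mem_singleton_iff, not_or] at h
      exact ⟨lt_of_le_of_ne x.2.1 (Ne.symm h.1), lt_of_le_of_ne x.2.2 h.2⟩
    refine G.pt_notMem_range_incl he hx' ?_
    rw [G.pt_of_mem x.2]
    exact hx

theorem isCompact_range_incl {S : Set E} (hS : S.Finite) : IsCompact (Set.range (G.incl S)) := by
  have : Finite S := hS
  have : CompactSpace (G.subgraph S).Space :=
    inferInstanceAs (CompactSpace (Quot (G.subgraph S).Glue))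
  exact isCompact_range (G.continuous_incl S)

theorem isOpen_image_pt_Ioo (e : E) : IsOpen (G.pt e '' Set.Ioo 0 (G.len e)) := by
  refine isOpen_coinduced.2 (isOpen_sigma_iff.2 fun e' => ?_)
  by_cases he : e = e'
  · subst he
    convert isOpen_Ioo.preimage (continuous_subtype_val (p := (· ∈ Set.Icc 0 (G.len e)))) using 1
    ext x
    constructor
    · rintro ⟨y, hy, h⟩
      have := G.pt_eq_pt_of_mem_Ioo hy x.2 (h.trans (G.pt_of_mem x.2).symm)
      exact this.2 ▸ hy
    · exact fun hx => ⟨x, hx, G.pt_of_mem x.2⟩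
  · convert isOpen_empty
    refine Set.eq_empty_of_forall_notMem fun x => ?_
    rintro ⟨y, hy, h⟩
    exact he (G.pt_eq_pt_of_mem_Ioo hy x.2 (h.trans (G.pt_of_mem x.2).symm)).1

/-- A point of the boundary of a subgraph is not an interior point of an edge. -/
theorem pt_notMem_bdry {S : Set E} (e : S) {x : ℝ} (hx : x ∈ Set.Ioo 0 (G.len e)) :
    (G.subgraph S).pt e x ∉ G.bdry S := fun h => by
  refine h.2 (mem_interior.2 ⟨_, ?_, G.isOpen_image_pt_Ioo e, ⟨x, hx, rfl⟩⟩)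
  rintro _ ⟨y, -, rfl⟩
  exact G.pt_mem_range_incl e.2 y

/-- A vertex of a subgraph which is the endpoint of an edge outside is a boundary point. -/
theorem pt_endCoord_mem_bdry {S : Set E} {a : S × Bool} {b : E × Bool}
    (hab : G.rel ((a.1 : E), a.2) b) (hb : b.1 ∉ S) :
    (G.subgraph S).pt a.1 ((G.subgraph S).endCoord a) ∈ G.bdry S := by
  have h : G.incl S ((G.subgraph S).pt a.1 ((G.subgraph S).endCoord a)) =
      G.pt b.1 (G.endCoord b) := G.pt_endCoord_eq hab
  rw [bdry, Set.mem_preimage, frontier_eq_closure_inter_closure]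
  refine ⟨subset_closure ⟨_, rfl⟩, ?_⟩
  rw [h]
  -- The vertex is a limit of interior points of the edge `b.1`, which lie outside the subgraph.
  have hcl : G.endCoord b ∈ closure (Set.Ioo 0 (G.len b.1)) := by
    rw [closure_Ioo (G.len_pos b.1).ne]
    exact G.endCoord_mem b
  exact map_mem_closure (G.continuous_pt b.1) hcl fun x hx => G.pt_notMem_range_incl hb hx

theorem eq_zero_of_mem_bdry {S : Set E} {f : G.Space → ℝ} (hf : Continuous f)
    (h : ∀ P ∉ Set.range (G.incl S), f P = 0) {Q : (G.subgraph S).Space} (hQ : Q ∈ G.bdry S) :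
    f (G.incl S Q) = 0 := by
  have hcl : G.incl S Q ∈ closure (Set.range (G.incl S))ᶜ := by
    have := (frontier_eq_closure_inter_closure (s := Set.range (G.incl S)) ▸ hQ.out :)
    exact this.2
  exact closure_minimal (s := (Set.range (G.incl S))ᶜ) (t := {P | f P = 0}) h
    (isClosed_eq hf continuous_const) hcl

variable {G}

/-- In a locally finite graph, compact sets do not meet the edges outside of large members of an
exhaustion. -/
theorem LocallyFinite.exists_disjoint (hG : G.LocallyFinite) {K : ℕ → Set E} (hK : Monotone K)
    (hex : ∀ e, ∃ n, e ∈ K n) {C : Set G.Space} (hC : IsCompact C) :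
    ∃ n, ∀ e ∉ K n, ∀ x, G.pt e x ∉ C := by
  have hmono : Monotone fun n => (Set.range (G.incl (K n)ᶜ))ᶜ := fun m n hmn P hP hP' => by
    refine hP ?_
    rw [mem_range_incl] at hP' ⊢
    obtain ⟨e, he, h⟩ := hP'
    exact ⟨e, fun h => he (hK hmn h), h⟩
  have hcov : C ⊆ ⋃ n, (Set.range (G.incl (K n)ᶜ))ᶜ := fun P _ => by
    obtain ⟨e, x, hx, rfl⟩ := G.exists_pt P
    -- Local finiteness: once `K n` contains `e` and the finitely many edges sharing a vertex with
    -- it, no point of `e` lies on an edge outside `K n`.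
    have hfin : ({e} ∪ ⋃ b : Bool, Prod.fst '' {a | G.vertexAt a = G.vertexAt (e, b)}).Finite :=
      (Set.finite_singleton e).union (Set.finite_iUnion fun b => (hG _).image _)
    obtain ⟨n, hn⟩ := (hK.directed_le).exists_mem_subset_of_finset_subset_biUnion
      (s := hfin.toFinset) (by
        intro e' _
        obtain ⟨n, hn⟩ := hex e'
        exact Set.mem_iUnion.2 ⟨n, hn⟩)
    refine Set.mem_iUnion.2 ⟨n, ?_⟩
    rw [Set.mem_compl_iff, mem_range_incl]
    rintro ⟨e', he', x', hx', h⟩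
    refine he' (hn ?_)
    rw [Set.Finite.coe_toFinset]
    rcases (G.pt_eq_pt_iff hx' hx).1 h with ⟨rfl, -⟩ | ⟨a, b, hab, rfl, -, rfl, -⟩
    · exact Or.inl rfl
    · exact Or.inr (Set.mem_iUnion.2 ⟨b.2, a, Quotient.sound hab, rfl⟩)
  obtain ⟨n, hn⟩ := hC.elim_directed_cover (fun n => (Set.range (G.incl (K n)ᶜ))ᶜ)
    (fun n => (G.isClosed_range_incl _).isOpen_compl) hcov hmono.directed_le
  exact ⟨n, fun e he x hx => hn hx (G.pt_mem_range_incl he x)⟩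

end MetricGraph

/-! ### Estimates for Sobolev functions on one edge. -/

namespace MetricGraph

variable {E : Type*} {G : MetricGraph E}

section Edge

variable {e : E}

theorem edge_measure_univ (G : MetricGraph E) (e : E) :
    (volume.restrict (Set.Icc (0 : ℝ) (G.len e))) Set.univ = ENNReal.ofReal (G.len e) := by
  simp

theorem EdgeL2.norm_le_of_ae_bound (u : G.EdgeL2 e) {M : ℝ} (hM : 0 ≤ M)
    (h : ∀ᵐ x ∂(volume.restrict (Set.Icc (0 : ℝ) (G.len e))), ‖u x‖ ≤ M) :
    ‖u‖ ≤ √(G.len e) * M := by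
  have := Lp.norm_le_of_ae_bound hM h
  refine this.trans_eq ?_
  congr 1
  rw [Real.sqrt_eq_rpow, measureUnivNNReal, edge_measure_univ, ENNReal.coe_toNNReal_eq_toReal,
    ENNReal.toReal_ofReal (G.len_pos e).le]
  simp

theorem EdgeL2.le_norm_of_ae_le (u : G.EdgeL2 e) {M : ℝ} (hM : 0 ≤ M)
    (h : ∀ᵐ x ∂(volume.restrict (Set.Icc (0 : ℝ) (G.len e))), M ≤ ‖u x‖) :
    √(G.len e) * M ≤ ‖u‖ := by
  have h1 : ‖Lp.const 2 (volume.restrict (Set.Icc (0 : ℝ) (G.len e))) M‖ ≤ ‖u‖ := by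
    refine Lp.norm_le_norm_of_ae_le ?_
    filter_upwards [h, Lp.coeFn_const (p := 2) (μ := volume.restrict (Set.Icc (0 : ℝ) (G.len e))) M]
      with x hx hc
    rw [hc]
    simpa [abs_of_nonneg hM] using hx
  have h2 := Lp.norm_const' (p := 2) (μ := volume.restrict (Set.Icc (0 : ℝ) (G.len e))) (c := M)
    (by simp) (by simp)
  refine le_trans (le_of_eq ?_) (h2 ▸ h1)
  rw [Real.sqrt_eq_rpow, mul_comm, Measure.real, edge_measure_univ]
  simp [abs_of_nonneg hM, (G.len_pos e).le]

theorem EdgeL2.restrict_restrict {s : Set ℝ} (hs : s ⊆ Set.Icc 0 (G.len e))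
    (hm : MeasurableSet s) :
    (volume.restrict (Set.Icc (0 : ℝ) (G.len e))).restrict s = volume.restrict s := by
  rw [Measure.restrict_restrict hm, Set.inter_eq_left.2 hs]

/-- Cauchy–Schwarz against the indicator of `(x, y]`. The length bound `h` is left free so as to
serve both whole edges and short subintervals. -/
theorem EdgeL2.abs_integral_le (g : G.EdgeL2 e) {x y h : ℝ} (hx : 0 ≤ x) (hxy : x ≤ y)
    (hy : y ≤ G.len e) (hh : y - x ≤ h) : |∫ s in x..y, g s| ≤ √h * ‖g‖ := by
  have hsub : Set.Ioc x y ⊆ Set.Icc 0 (G.len e) := fun s hs => ⟨hx.trans hs.1.le, hs.2.trans hy⟩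
  have hfin : (volume.restrict (Set.Icc (0 : ℝ) (G.len e))) (Set.Ioc x y) ≠ ⊤ := measure_ne_top _ _
  have h1 := L2.inner_indicatorConstLp_one (𝕜 := ℝ) measurableSet_Ioc hfin g
  rw [restrict_restrict hsub measurableSet_Ioc] at h1
  rw [intervalIntegral.integral_of_le hxy, ← h1, ← Real.norm_eq_abs]
  refine (norm_inner_le_norm _ _).trans (mul_le_mul_of_nonneg_right ?_ (norm_nonneg _))
  rw [norm_indicatorConstLp (by simp) (by simp), Measure.real,
    Measure.restrict_apply measurableSet_Ioc, Set.inter_eq_left.2 hsub, Real.volume_Ioc,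
    ENNReal.toReal_ofReal (sub_nonneg.2 hxy), Real.sqrt_eq_rpow, norm_one, one_mul]
  simp only [ENNReal.toReal_ofNat]
  exact Real.rpow_le_rpow (sub_nonneg.2 hxy) hh (by norm_num)

end Edge

namespace IsSobolev

variable {f : G.Space → ℝ} {u g : G.L2}

theorem sub_eq (hf : G.IsSobolev f u g) {e : E} {x y : ℝ} (hx : x ∈ Set.Icc 0 (G.len e))
    (hy : y ∈ Set.Icc 0 (G.len e)) :
    f (G.pt e y) - f (G.pt e x) = ∫ s in x..y, g e s := by
  rw [hf.integral_eq e x hx, hf.integral_eq e y hy, ← intervalIntegral.integral_interval_sub_left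
    (EdgeL2.intervalIntegrable _ hy) (EdgeL2.intervalIntegrable _ hx)]
  ring

/-- Sobolev functions are Hölder continuous on the edges. -/
theorem abs_sub_le (hf : G.IsSobolev f u g) {e : E} {x y h : ℝ} (hx : x ∈ Set.Icc 0 (G.len e))
    (hy : y ∈ Set.Icc 0 (G.len e)) (hh : |x - y| ≤ h) :
    |f (G.pt e x) - f (G.pt e y)| ≤ √h * ‖g e‖ := by
  rcases le_total x y with hxy | hxy
  · rw [abs_sub_comm, hf.sub_eq hx hy]
    rw [abs_sub_comm] at hh
    exact EdgeL2.abs_integral_le _ hx.1 hxy hy.2 ((le_abs_self _).trans hh)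
  · rw [hf.sub_eq hy hx]
    exact EdgeL2.abs_integral_le _ hy.1 hxy hx.2 ((le_abs_self _).trans hh)

theorem abs_sub_le_edge (hf : G.IsSobolev f u g) {e : E} {x y : ℝ} (hx : x ∈ Set.Icc 0 (G.len e))
    (hy : y ∈ Set.Icc 0 (G.len e)) :
    |f (G.pt e x) - f (G.pt e y)| ≤ √(G.len e) * ‖g e‖ :=
  hf.abs_sub_le hx hy (by rw [abs_le]; constructor <;> linarith [hx.1, hx.2, hy.1, hy.2])

/-- Trace estimate on an edge. -/
theorem abs_le (hf : G.IsSobolev f u g) {e : E} {x : ℝ} (hx : x ∈ Set.Icc 0 (G.len e)) :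
    |f (G.pt e x)| ≤ (√(G.len e))⁻¹ * ‖u e‖ + √(G.len e) * ‖g e‖ := by
  have hl : 0 < √(G.len e) := Real.sqrt_pos.2 (G.len_pos e)
  by_contra! hlt
  have h0 : 0 ≤ (√(G.len e))⁻¹ * ‖u e‖ := by positivity
  -- The function varies by at most `√(G.len e) * ‖g e‖` on the edge, so it would exceed this `M` in
  -- absolute value everywhere, making `‖u e‖` too large.
  have := EdgeL2.le_norm_of_ae_le (u e) (M := |f (G.pt e x)| - √(G.len e) * ‖g e‖) (by linarith) (by
    filter_upwards [hf.ae_eq e, ae_restrict_mem measurableSet_Icc] with y hy hyI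
    rw [hy, Real.norm_eq_abs]
    have h1 := hf.abs_sub_le_edge hx hyI
    have h2 := abs_sub_abs_le_abs_sub (f (G.pt e x)) (f (G.pt e y))
    linarith)
  rw [← le_inv_mul_iff₀ hl] at this
  linarith

/-- The right endpoint is negligible; omitting it suits `exists_mem_subinterval`, where the floor
would give the forbidden index `N` there. -/
theorem norm_edge_le (hf : G.IsSobolev f u g) {e : E} {M : ℝ} (hM : 0 ≤ M)
    (h : ∀ x ∈ Set.Ico 0 (G.len e), |f (G.pt e x)| ≤ M) : ‖u e‖ ≤ √(G.len e) * M := by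
  refine EdgeL2.norm_le_of_ae_bound _ hM ?_
  have hne : ∀ᵐ x ∂(volume.restrict (Set.Icc (0 : ℝ) (G.len e))), x ≠ G.len e :=
    ae_restrict_of_ae (by simp [ae_iff])
  filter_upwards [hf.ae_eq e, ae_restrict_mem measurableSet_Icc, hne] with x hx hxI hxn
  rw [hx]
  exact h x ⟨hxI.1, lt_of_le_of_ne hxI.2 hxn⟩

theorem abs_le_norm (hf : G.IsSobolev f u g) {e : E} {x : ℝ} (hx : x ∈ Set.Icc 0 (G.len e)) :
    |f (G.pt e x)| ≤ (√(G.len e))⁻¹ * ‖u‖ + √(G.len e) * ‖g‖ := by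
  refine (hf.abs_le hx).trans ?_
  gcongr
  · exact lp.norm_apply_le_norm two_ne_zero u e
  · exact lp.norm_apply_le_norm two_ne_zero g e

theorem sub {f₁ f₂ : G.Space → ℝ} {u₁ g₁ u₂ g₂ : G.L2} (h₁ : G.IsSobolev f₁ u₁ g₁)
    (h₂ : G.IsSobolev f₂ u₂ g₂) : G.IsSobolev (fun x => f₁ x - f₂ x) (u₁ - u₂) (g₁ - g₂) := by
  have := h₁.add (h₂.smul (-1))
  simpa [← sub_eq_add_neg] using this

end IsSobolev

/-! ### Boundedness on connected graphs of finite length. -/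

theorem summable_len (hlen : G.totalLength ≠ ⊤) : Summable G.len := by
  have := ENNReal.summable_toReal hlen
  simpa [ENNReal.toReal_ofReal, (G.len_pos _).le] using this

/-- The oscillation of a Sobolev function on a connected graph of finite length: the values form an
interval which is covered by the images of the edges. -/
theorem IsSobolev.abs_sub_le_of_connected [Countable E] (hconn : G.IsConnected)
    (hlen : G.totalLength ≠ ⊤) {f : G.Space → ℝ} {u g : G.L2} (hf : G.IsSobolev f u g)
    (P Q : G.Space) : |f P - f Q| ≤ √(∑' e, G.len e) * ‖g‖ := by
  wlog hPQ : f Q ≤ f P generalizing P Q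
  · rw [abs_sub_comm]
    exact this Q P (not_le.1 hPQ).le
  have hconn' : ConnectedSpace G.Space := hconn
  -- Connectedness enters as the intermediate value theorem, so no path from `Q` to `P` is needed.
  -- The length of the interval is at most the sum of the oscillations on the edges, which
  -- Cauchy–Schwarz then bounds.
  have hsub : Set.Icc (f Q) (f P) ⊆ ⋃ e, (fun x => f (G.pt e x)) '' Set.Icc 0 (G.len e) := by
    intro y hy
    obtain ⟨R, rfl⟩ := mem_range_of_exists_le_of_exists_ge hf.cont ⟨Q, hy.1⟩ ⟨P, hy.2⟩
    obtain ⟨e, x, hx, rfl⟩ := G.exists_pt R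
    exact Set.mem_iUnion.2 ⟨e, x, hx, rfl⟩
  have hvol : ∀ e, volume ((fun x => f (G.pt e x)) '' Set.Icc 0 (G.len e)) ≤
      ENNReal.ofReal (√(G.len e) * ‖g e‖) := by
    intro e
    refine (Real.volume_le_diam _).trans (Metric.ediam_le ?_)
    rintro _ ⟨x, hx, rfl⟩ _ ⟨y, hy, rfl⟩
    rw [edist_dist, Real.dist_eq]
    exact ENNReal.ofReal_le_ofReal (hf.abs_sub_le_edge hx hy)
  have hsum := summable_len hlen
  have hCS := Real.summable_and_inner_le_Lp_mul_Lq_tsum_of_nonneg (p := 2) (q := 2)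
    ⟨by norm_num, by norm_num, by norm_num⟩ (f := fun e => √(G.len e)) (g := fun e => ‖g e‖) (fun e => Real.sqrt_nonneg _)
    (fun e => norm_nonneg _) (by simpa [Real.sq_sqrt (G.len_pos _).le] using hsum)
    (by simpa using (lp.hasSum_norm_sq g).summable)
  have h1 : ENNReal.ofReal (f P - f Q) ≤ ENNReal.ofReal (∑' e, √(G.len e) * ‖g e‖) := by
    rw [← Real.volume_Icc, ENNReal.ofReal_tsum_of_nonneg (fun e => by positivity) hCS.1]
    exact (measure_mono hsub).trans ((measure_iUnion_le _).trans (ENNReal.tsum_le_tsum hvol))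
  rw [ENNReal.ofReal_le_ofReal_iff (tsum_nonneg fun e => by positivity)] at h1
  rw [abs_of_nonneg (sub_nonneg.2 hPQ)]
  refine (h1.trans hCS.2).trans_eq ?_
  congr 1
  · rw [← Real.sqrt_eq_rpow]
    simp [Real.sq_sqrt (G.len_pos _).le]
  · rw [← Real.sqrt_eq_rpow]
    simp [(lp.hasSum_norm_sq g).tsum_eq]

/-- Sobolev functions on a connected graph of finite length are bounded. -/
theorem exists_sq_le_of_connected [Countable E] (hconn : G.IsConnected)
    (hlen : G.totalLength ≠ ⊤) : ∃ M > 0, ∀ (f : G.Space → ℝ) (u g : G.L2), G.IsSobolev f u g →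
      ∀ P, f P ^ 2 ≤ M * (‖u‖ ^ 2 + ‖g‖ ^ 2) := by
  have hconn' : ConnectedSpace G.Space := hconn
  obtain ⟨e, x, hx, -⟩ := G.exists_pt (Classical.arbitrary G.Space)
  have hl := Real.sqrt_pos.2 (G.len_pos e)
  -- The trace constants of one fixed edge plus the constant for the oscillation over the whole
  -- graph.
  set C := (√(G.len e))⁻¹ + √(G.len e) + √(∑' e, G.len e) with hC
  have hC0 : 0 < C := by positivity
  refine ⟨2 * C ^ 2, by positivity, fun f u g hf P => ?_⟩
  have h1 := hf.abs_le_norm hx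
  have h2 := hf.abs_sub_le_of_connected hconn hlen P (G.pt e x)
  have h3 : |f P| ≤ C * (‖u‖ + ‖g‖) := by
    have h4 := abs_sub_abs_le_abs_sub (f P) (f (G.pt e x))
    have h5 : 0 ≤ √(∑' e, G.len e) * ‖u‖ := by positivity
    have h6 : 0 ≤ √(G.len e) * ‖u‖ := by positivity
    have h7 : 0 ≤ (√(G.len e))⁻¹ * ‖g‖ := by positivity
    rw [hC]
    nlinarith
  rw [← sq_abs]
  calc |f P| ^ 2 ≤ (C * (‖u‖ + ‖g‖)) ^ 2 := by gcongr
    _ ≤ _ := by nlinarith [mul_nonneg (sq_nonneg C) (sq_nonneg (‖u‖ - ‖g‖))]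

/-! ### Compactness of the Sobolev embedding. -/

/-- The part with index `i` of an interval `[0, l]` which is divided into `N` equal parts. -/
def subinterval (l : ℝ) (N i : ℕ) : Set ℝ := Set.Icc (i * (l / N)) ((i + 1) * (l / N))

theorem isCompact_subinterval (l : ℝ) (N i : ℕ) : IsCompact (subinterval l N i) :=
  isCompact_Icc

theorem measurableSet_subinterval (l : ℝ) (N i : ℕ) : MeasurableSet (subinterval l N i) :=
  measurableSet_Icc

theorem subinterval_subset {l : ℝ} (hl : 0 ≤ l) {N i : ℕ} (hi : i < N) :
    subinterval l N i ⊆ Set.Icc 0 l := by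
  refine Set.Icc_subset_Icc (by positivity) ?_
  have hN : (0 : ℝ) < N := by exact_mod_cast (Nat.zero_le i).trans_lt hi
  have : (i + 1 : ℝ) ≤ N := by exact_mod_cast hi
  calc (i + 1 : ℝ) * (l / N) ≤ N * (l / N) := by gcongr
    _ = l := by field_simp

theorem exists_mem_subinterval {l x : ℝ} {N : ℕ} (hN : 0 < N) (hx : x ∈ Set.Ico 0 l) :
    ∃ i < N, x ∈ subinterval l N i := by
  have hl : 0 < l := hx.1.trans_lt hx.2
  have hN' : (0 : ℝ) < N := by exact_mod_cast hN
  have hh : 0 < l / N := by positivity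
  refine ⟨⌊x / (l / N)⌋₊, ?_, ?_, ?_⟩
  · rw [Nat.floor_lt (by have := hx.1; positivity), div_lt_iff₀ hh]
    calc x < l := hx.2
      _ = N * (l / N) := by field_simp
  · rw [← le_div_iff₀ hh]
    exact Nat.floor_le (by have := hx.1; positivity)
  · rw [← div_le_iff₀ hh]
    exact (Nat.lt_floor_add_one _).le

/-- The indicator function of a part of an edge, as an element of `L²` of the edge. -/
def stepEdge (G : MetricGraph E) (e : E) (N i : ℕ) : G.EdgeL2 e :=
  indicatorConstLp 2 (measurableSet_subinterval (G.len e) N i)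
    (measure_ne_top _ _) 1

open Classical in
/-- The indicator function of a part of an edge, as an element of `L²` of the graph. -/
def step (G : MetricGraph E) (e : E) (N i : ℕ) : G.L2 := lp.single 2 e (stepEdge G e N i)

theorem inner_step (e : E) {N i : ℕ} (hi : i < N) (u : G.L2) :
    inner ℝ (step G e N i) u = ∫ x in subinterval (G.len e) N i, u e x := by
  have h := L2.inner_indicatorConstLp_one (𝕜 := ℝ)
    (μ := volume.restrict (Set.Icc (0 : ℝ) (G.len e)))
    (measurableSet_subinterval (G.len e) N i) (measure_ne_top _ _) (u e)
  rw [EdgeL2.restrict_restrict (subinterval_subset (G.len_pos e).le hi)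
    (measurableSet_subinterval _ _ _)] at h
  classical
  exact (lp.inner_single_left e (stepEdge G e N i) u).trans h

/-- A Sobolev function with vanishing means on the parts of an edge is small on the edge. -/
theorem IsSobolev.norm_edge_le_of_inner_step_eq_zero {f : G.Space → ℝ} {u g : G.L2}
    (hf : G.IsSobolev f u g) {e : E} {N : ℕ} (hN : 0 < N)
    (h : ∀ i < N, inner ℝ (step G e N i) u = 0) :
    ‖u e‖ ≤ √(G.len e) * (√(G.len e / N) * ‖g e‖) := by
  refine hf.norm_edge_le (by positivity) fun x hx => ?_
  obtain ⟨i, hi, hxi⟩ := exists_mem_subinterval hN hx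
  have hsub := subinterval_subset (G.len_pos e).le hi
  have hlen : 0 < G.len e / N := by have := G.len_pos e; positivity
  have hvol : volume.real (subinterval (G.len e) N i) = G.len e / N := by
    rw [subinterval, Real.volume_real_Icc_of_le (by nlinarith)]
    ring
  have hfin : volume (subinterval (G.len e) N i) < ⊤ := measure_Icc_lt_top
  have hae : ∀ᵐ y ∂(volume.restrict (subinterval (G.len e) N i)), u e y = f (G.pt e y) :=
    ae_restrict_of_ae_restrict_of_subset hsub (hf.ae_eq e)
  -- As `f` has mean zero on the part containing `x`, the value at `x` is the mean of `f x - f y`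
  -- over that part, where `|x - y| ≤ G.len e / N`.
  have hint : ∫ y in subinterval (G.len e) N i, (f (G.pt e x) - f (G.pt e y)) =
      f (G.pt e x) * (G.len e / N) := by
    have hcont : Continuous fun y => f (G.pt e y) := hf.cont.comp (G.continuous_pt e)
    have h0 : ∫ y in subinterval (G.len e) N i, f (G.pt e y) = 0 := by
      rw [← h i hi, inner_step e hi]
      exact integral_congr_ae (hae.mono fun y hy => hy.symm)
    have hI := isCompact_subinterval (G.len e) N i
    rw [integral_sub (continuousOn_const.integrableOn_compact hI)
      (hcont.continuousOn.integrableOn_compact hI), h0, setIntegral_const, hvol]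
    simp [mul_comm]
  have hbound := norm_setIntegral_le_of_norm_le_const hfin
    (f := fun y => f (G.pt e x) - f (G.pt e y)) (C := √(G.len e / N) * ‖g e‖) fun y hy => by
      refine hf.abs_sub_le (hsub hxi) (hsub hy) ?_
      have h1 := hxi.1
      have h2 := hxi.2
      have h3 := hy.1
      have h4 := hy.2
      rw [_root_.abs_le]
      constructor <;> linarith
  rw [hint, hvol, norm_mul, Real.norm_of_nonneg hlen.le] at hbound
  exact le_of_mul_le_mul_right hbound hlen

/-- The finite set `F` leaves edges of total length below `ε / (2 * M)`, where the uniform bound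
costs at most half of `ε`. On the edges of `F`, orthogonality to the step functions costs the other
half if `N` is large. Thus `V` is the span of finitely many step functions. -/
theorem isCompactForm_H1 [Countable E] (hconn : G.IsConnected) (hlen : G.totalLength ≠ ⊤) :
    IsCompactForm G.H1 := by
  intro ε hε
  obtain ⟨M, hM, hMf⟩ := exists_sq_le_of_connected hconn hlen
  have hsum := summable_len hlen
  obtain ⟨F, hF⟩ := ((tendsto_tsum_compl_atTop_zero G.len).eventually
    (gt_mem_nhds (show 0 < ε / (2 * M) by positivity))).exists
  obtain ⟨N, hN⟩ := exists_nat_gt ((∑' e, G.len e) ^ 2 / (ε / 2))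
  have hN0 : (0 : ℝ) < N := lt_of_le_of_lt (by positivity) hN
  refine ⟨Submodule.span ℝ ((fun q : E × ℕ => step G q.1 N q.2) '' (F ×ˢ Finset.range N : Finset _)),
    FiniteDimensional.span_of_finite ℝ ((Finset.finite_toSet _).image _), ?_⟩
  rintro ⟨u, g⟩ ⟨f, hf⟩ hu
  have hin : ∀ e ∈ F, ‖u e‖ ^ 2 ≤ ε / 2 * ‖g e‖ ^ 2 := by
    intro e he
    have h1 := hf.norm_edge_le_of_inner_step_eq_zero (Nat.cast_pos.1 hN0) fun i hi =>
      hu _ (Submodule.subset_span ⟨(e, i), by simp [he, hi], rfl⟩)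
    have hle : G.len e ≤ ∑' e, G.len e := hsum.le_tsum e fun _ _ => (G.len_pos _).le
    have hl := (G.len_pos e).le
    have h2 : G.len e * (G.len e / N) ≤ ε / 2 := by
      rw [div_lt_iff₀ (by positivity)] at hN
      rw [mul_div_assoc', div_le_iff₀ hN0, mul_comm (ε / 2)]
      exact (by nlinarith : G.len e * G.len e ≤ (∑' e, G.len e) ^ 2).trans hN.le
    calc ‖u e‖ ^ 2 ≤ (√(G.len e) * (√(G.len e / N) * ‖g e‖)) ^ 2 := by gcongr
      _ = G.len e * (G.len e / N) * ‖g e‖ ^ 2 := by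
        rw [mul_pow, mul_pow, Real.sq_sqrt hl, Real.sq_sqrt (by positivity)]
        ring
      _ ≤ _ := by gcongr
  have hout : ∀ e, ‖u e‖ ^ 2 ≤ G.len e * (M * (‖u‖ ^ 2 + ‖g‖ ^ 2)) := by
    intro e
    have h1 := hf.norm_edge_le (e := e) (Real.sqrt_nonneg (M * (‖u‖ ^ 2 + ‖g‖ ^ 2)))
      fun x _ => Real.abs_le_sqrt (hMf f u g hf _)
    calc ‖u e‖ ^ 2 ≤ (√(G.len e) * √(M * (‖u‖ ^ 2 + ‖g‖ ^ 2))) ^ 2 := by gcongr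
      _ = _ := by rw [mul_pow, Real.sq_sqrt (G.len_pos e).le, Real.sq_sqrt (by positivity)]
  have hu2 := lp.hasSum_norm_sq u
  have hg2 := lp.hasSum_norm_sq g
  have e1 : ‖u‖ ^ 2 = ∑ e ∈ F, ‖u e‖ ^ 2 + ∑' e : {e // e ∉ F}, ‖u e‖ ^ 2 := by
    rw [hu2.summable.sum_add_tsum_subtype_compl F, hu2.tsum_eq]
  have e2 : ∑ e ∈ F, ‖u e‖ ^ 2 ≤ ε / 2 * ‖g‖ ^ 2 := by
    refine (Finset.sum_le_sum hin).trans ?_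
    rw [← Finset.mul_sum]
    gcongr
    exact sum_le_hasSum F (fun _ _ => sq_nonneg _) hg2
  have e3 : ∑' e : {e // e ∉ F}, ‖u e‖ ^ 2 ≤ ε / 2 * (‖u‖ ^ 2 + ‖g‖ ^ 2) := by
    refine (Summable.tsum_le_tsum (fun e : {e // e ∉ F} => hout e) (hu2.summable.subtype _)
      ((hsum.subtype _).mul_right _)).trans ?_
    rw [tsum_mul_right, ← mul_assoc]
    gcongr
    have : (∑' e : {e // e ∉ F}, G.len e) * (2 * M) ≤ ε := ((lt_div_iff₀ (by positivity)).1 hF).le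
    linarith
  have := sq_nonneg ‖u‖
  change ‖u‖ ^ 2 ≤ ε * (‖u‖ ^ 2 + ‖g‖ ^ 2)
  nlinarith

/-! ### Closedness of the form domains. -/

/-- Limits of Sobolev functions in the Sobolev norm are Sobolev functions, and the convergence is
pointwise. -/
theorem exists_isSobolev_of_tendsto {f : ℕ → G.Space → ℝ} {u g : ℕ → G.L2} {u₀ g₀ : G.L2}
    (hf : ∀ n, G.IsSobolev (f n) (u n) (g n)) (hu : Tendsto u atTop (𝓝 u₀))
    (hg : Tendsto g atTop (𝓝 g₀)) :
    ∃ f₀, G.IsSobolev f₀ u₀ g₀ ∧ ∀ P, Tendsto (fun n => f n P) atTop (𝓝 (f₀ P)) := by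
  -- The trace estimate, applied to differences, turns Sobolev convergence into pointwise
  -- convergence.
  have hcauchy : ∀ P, CauchySeq fun n => f n P := by
    intro P
    obtain ⟨e, x, hx, rfl⟩ := G.exists_pt P
    have hu' := cauchySeq_iff_tendsto_dist_atTop_0.1 hu.cauchySeq
    have hg' := cauchySeq_iff_tendsto_dist_atTop_0.1 hg.cauchySeq
    rw [cauchySeq_iff_tendsto_dist_atTop_0]
    refine squeeze_zero (fun _ => dist_nonneg) (fun n => ?_)
      (by simpa using (hu'.const_mul (√(G.len e))⁻¹).add (hg'.const_mul √(G.len e)))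
    rw [Real.dist_eq, dist_eq_norm, dist_eq_norm]
    exact ((hf n.1).sub (hf n.2)).abs_le_norm hx
  choose f₀ hf₀ using fun P => cauchySeq_tendsto_of_complete (hcauchy P)
  have hint : ∀ e, ∀ x ∈ Set.Icc (0 : ℝ) (G.len e),
      f₀ (G.pt e x) = f₀ (G.pt e 0) + ∫ s in (0 : ℝ)..x, g₀ e s := by
    intro e x hx
    have hI : Tendsto (fun n => ∫ s in (0 : ℝ)..x, g n e s) atTop
        (𝓝 (∫ s in (0 : ℝ)..x, g₀ e s)) := by
      rw [tendsto_iff_norm_sub_tendsto_zero] at hg ⊢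
      refine squeeze_zero (fun _ => norm_nonneg _) (fun n => ?_)
        (by simpa using hg.const_mul √(G.len e))
      rw [← intervalIntegral.integral_sub (EdgeL2.intervalIntegrable _ hx)
        (EdgeL2.intervalIntegrable _ hx)]
      have h1 : ∫ s in (0 : ℝ)..x, (g n e s - g₀ e s) = ∫ s in (0 : ℝ)..x, (g n - g₀) e s :=
        (EdgeL2.integral_congr hx (Lp.coeFn_sub (g n e) (g₀ e))).symm
      rw [h1]
      refine (EdgeL2.abs_integral_le _ le_rfl hx.1 hx.2 (h := G.len e) (by linarith [hx.2])).trans ?_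
      gcongr
      exact lp.norm_apply_le_norm two_ne_zero (g n - g₀) e
    refine tendsto_nhds_unique (hf₀ _) (((hf₀ (G.pt e 0)).add hI).congr fun n => ?_)
    exact ((hf n).integral_eq e x hx).symm
  refine ⟨f₀, ⟨?_, ?_, hint⟩, hf₀⟩
  · refine G.continuous_of_edges fun e => ?_
    have h0 : ContinuousOn (fun x => ∫ s in (0 : ℝ)..x, g₀ e s) (Set.Icc 0 (G.len e)) := by
      have hi : IntegrableOn (g₀ e) (Set.uIcc 0 (G.len e)) := by
        rw [Set.uIcc_of_le (G.len_pos e).le]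
        exact (Lp.memLp (g₀ e)).integrable (by norm_num)
      have := intervalIntegral.continuousOn_primitive_interval hi
      rwa [Set.uIcc_of_le (G.len_pos e).le] at this
    exact (continuousOn_const.add h0).congr fun x hx => hint e x hx
  · intro e
    have hue : Tendsto (fun n => u n e) atTop (𝓝 (u₀ e)) := by
      rw [tendsto_iff_norm_sub_tendsto_zero] at hu ⊢
      exact squeeze_zero (fun _ => norm_nonneg _)
        (fun n => lp.norm_apply_le_norm two_ne_zero (u n - u₀) e) hu
    -- A subsequence converges almost everywhere, which identifies `u₀ e` with the pointwise limit.
    obtain ⟨ns, hns, hae⟩ := (tendstoInMeasure_of_tendsto_Lp hue).exists_seq_tendsto_ae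
    have hall : ∀ᵐ x ∂(volume.restrict (Set.Icc (0 : ℝ) (G.len e))), ∀ n,
        u n e x = f n (G.pt e x) := ae_all_iff.2 fun n => (hf n).ae_eq e
    filter_upwards [hae, hall] with x hx hx'
    simp only [hx'] at hx
    exact tendsto_nhds_unique hx ((hf₀ _).comp hns.tendsto_atTop)

theorem isClosed_H1 : IsClosed (G.H1 : Set (G.L2 × G.L2)) := by
  refine IsSeqClosed.isClosed fun p p₀ hp hlim => ?_
  choose f hf using hp
  obtain ⟨f₀, hf₀, -⟩ := exists_isSobolev_of_tendsto hf
    ((continuous_fst.tendsto p₀).comp hlim) ((continuous_snd.tendsto p₀).comp hlim)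
  exact ⟨f₀, hf₀⟩

theorem isClosed_H1Vanishing (A : Set G.Space) :
    IsClosed (G.H1Vanishing A : Set (G.L2 × G.L2)) := by
  refine IsSeqClosed.isClosed fun p p₀ hp hlim => ?_
  choose f hf hA using hp
  obtain ⟨f₀, hf₀, hpt⟩ := exists_isSobolev_of_tendsto hf
    ((continuous_fst.tendsto p₀).comp hlim) ((continuous_snd.tendsto p₀).comp hlim)
  refine ⟨f₀, hf₀, fun x hx => ?_⟩
  refine tendsto_nhds_unique (hpt x) (tendsto_const_nhds.congr fun n => (hA n x hx).symm)

theorem isClosed_H10 : IsClosed (G.H10 : Set (G.L2 × G.L2)) :=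
  isClosed_H1.inter G.H1c.isClosed_topologicalClosure

/-! ### Density of the form domains -/

open Classical in
/-- A function on an edge as an element of `L²` of the graph. -/
def edgeFun (G : MetricGraph E) (e : E) {φ : ℝ → ℝ}
    (hφ : MemLp φ 2 (volume.restrict (Set.Icc (0 : ℝ) (G.len e)))) : G.L2 :=
  lp.single 2 e (hφ.toLp φ)

theorem edgeFun_self {e : E} {φ : ℝ → ℝ}
    (hφ : MemLp φ 2 (volume.restrict (Set.Icc (0 : ℝ) (G.len e)))) :
    edgeFun G e hφ e = hφ.toLp φ := by
  classical
  exact lp.single_apply_self 2 e _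

theorem edgeFun_ne {e e' : E} (h : e' ≠ e) {φ : ℝ → ℝ}
    (hφ : MemLp φ 2 (volume.restrict (Set.Icc (0 : ℝ) (G.len e)))) :
    edgeFun G e hφ e' = 0 := by
  classical
  exact lp.single_apply_ne 2 e _ h

theorem inner_edgeFun {e : E} {φ : ℝ → ℝ}
    (hφ : MemLp φ 2 (volume.restrict (Set.Icc (0 : ℝ) (G.len e)))) (w : G.L2) :
    inner ℝ (edgeFun G e hφ) w = ∫ x in Set.Icc (0 : ℝ) (G.len e), φ x * w e x := by
  classical
  refine (lp.inner_single_left (𝕜 := ℝ) e (hφ.toLp φ) w).trans ?_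
  rw [L2.inner_def]
  refine integral_congr_ae ?_
  filter_upwards [hφ.coeFn_toLp] with x hx
  rw [hx]
  simp [mul_comm]

theorem integral_zero_edge (e : E) {x : ℝ} (hx : x ∈ Set.Icc 0 (G.len e)) :
    ∫ s in (0 : ℝ)..x, (0 : G.EdgeL2 e) s = 0 := by
  refine (EdgeL2.integral_congr hx
    (Lp.coeFn_zero ℝ 2 (volume.restrict (Set.Icc (0 : ℝ) (G.len e))))).trans ?_
  simp

/-- Smooth functions with compact support in the interior of an edge are Sobolev functions. -/
theorem exists_isSobolev_edgeFun (e : E) {φ : ℝ → ℝ} (hφ : ContDiff ℝ 1 φ)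
    (hsupp : ∀ x ∉ Set.Ioo 0 (G.len e), φ x = 0)
    (h₀ : MemLp φ 2 (volume.restrict (Set.Icc (0 : ℝ) (G.len e))))
    (h₁ : MemLp (deriv φ) 2 (volume.restrict (Set.Icc (0 : ℝ) (G.len e)))) :
    ∃ f, G.IsSobolev f (edgeFun G e h₀) (edgeFun G e h₁) ∧
      ∀ P ∉ G.pt e '' Set.Ioo 0 (G.len e), f P = 0 := by
  classical
  have hend : ∀ a : E × Bool, (if a.1 = e then φ (G.endCoord a) else 0) = 0 := by
    intro a
    split_ifs with h
    · subst h
      exact hsupp _ (G.endCoord_notMem_Ioo a)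
    · rfl
  obtain ⟨f, hf⟩ := G.exists_fun (fun e' x => if e' = e then φ x else 0)
    fun a b _ => (hend a).trans (hend b).symm
  have hself : ∀ x ∈ Set.Icc 0 (G.len e), f (G.pt e x) = φ x := fun x hx => by
    rw [hf e x hx, if_pos rfl]
  have hne : ∀ e' ≠ e, ∀ x ∈ Set.Icc 0 (G.len e'), f (G.pt e' x) = 0 := fun e' he' x hx => by
    rw [hf e' x hx, if_neg he']
  refine ⟨f, ⟨G.continuous_of_edges fun e' => ?_, fun e' => ?_, fun e' x hx => ?_⟩, fun P hP => ?_⟩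
  · by_cases he : e' = e
    · subst he
      exact hφ.continuous.continuousOn.congr hself
    · exact continuousOn_const.congr (hne e' he)
  · by_cases he : e' = e
    · subst he
      rw [edgeFun_self]
      filter_upwards [h₀.coeFn_toLp, ae_restrict_mem measurableSet_Icc] with x hx hxI
      rw [hx, hself x hxI]
    · rw [edgeFun_ne he]
      filter_upwards [Lp.coeFn_zero ℝ 2 (volume.restrict (Set.Icc (0 : ℝ) (G.len e'))),
        ae_restrict_mem measurableSet_Icc] with x hx hxI
      rw [hx, hne e' he x hxI]
      rfl
  · have h0 : (0 : ℝ) ∈ Set.Icc 0 (G.len e') := ⟨le_rfl, (G.len_pos e').le⟩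
    by_cases he : e' = e
    · subst he
      rw [edgeFun_self, EdgeL2.integral_congr hx h₁.coeFn_toLp, hself x hx, hself 0 h0,
        intervalIntegral.integral_deriv_eq_sub (fun y _ => (hφ.differentiable one_ne_zero) y)
          ((hφ.continuous_deriv le_rfl).intervalIntegrable _ _)]
      ring
    · rw [edgeFun_ne he, integral_zero_edge _ hx, hne e' he x hx, hne e' he 0 h0, add_zero]
  · obtain ⟨e', x, hx, rfl⟩ := G.exists_pt P
    by_cases he : e' = e
    · subst he
      rw [hself x hx]
      exact hsupp x fun h => hP ⟨x, h, rfl⟩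
    · exact hne e' he x hx

/-- A vector orthogonal to the first components integrates to zero against every test function
inside an edge, so it vanishes by the fundamental lemma of the calculus of variations. -/
theorem dense_fst_of_forall_mem {D : Submodule ℝ (G.L2 × G.L2)}
    (hD : ∀ e f u g, G.IsSobolev f u g → (∀ P ∉ G.pt e '' Set.Ioo 0 (G.len e), f P = 0) →
      (u, g) ∈ D) : Dense (Prod.fst '' (D : Set (G.L2 × G.L2))) := by
  have key : (D.map (LinearMap.fst ℝ G.L2 G.L2)).topologicalClosure = ⊤ := by
    rw [Submodule.topologicalClosure_eq_top_iff, Submodule.eq_bot_iff]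
    intro w hw
    ext e : 2
    refine Lp.ext ?_
    have hint : IntegrableOn (w e) (Set.Icc 0 (G.len e)) :=
      (Lp.memLp (w e)).integrable (by norm_num)
    have h := isOpen_Ioo.ae_eq_zero_of_integral_contDiff_smul_eq_zero
      (U := Set.Ioo 0 (G.len e)) (f := w e) (μ := volume)
      (hint.mono_set Set.Ioo_subset_Icc_self).locallyIntegrableOn ?_
    · have hIoo : ∀ᵐ x ∂(volume.restrict (Set.Icc (0 : ℝ) (G.len e))),
          x ∈ Set.Ioo 0 (G.len e) := by
        rw [← restrict_Ioo_eq_restrict_Icc]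
        exact ae_restrict_mem measurableSet_Ioo
      filter_upwards [ae_restrict_of_ae h, hIoo,
        Lp.coeFn_zero ℝ 2 (volume.restrict (Set.Icc (0 : ℝ) (G.len e)))] with x hx hxI hx0
      exact (hx hxI).trans hx0.symm
    · intro φ hφ hc hsupp
      have hz : ∀ x ∉ Set.Ioo 0 (G.len e), φ x = 0 := fun x hx =>
        image_eq_zero_of_notMem_tsupport fun h => hx (hsupp h)
      have hφ1 : ContDiff ℝ 1 φ := hφ.of_le (by exact_mod_cast le_top)
      have h₀ : MemLp φ 2 (volume.restrict (Set.Icc (0 : ℝ) (G.len e))) :=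
        hφ1.continuous.memLp_of_hasCompactSupport hc
      have h₁ : MemLp (deriv φ) 2 (volume.restrict (Set.Icc (0 : ℝ) (G.len e))) :=
        (hφ1.continuous_deriv le_rfl).memLp_of_hasCompactSupport hc.deriv
      obtain ⟨f, hf, hf0⟩ := exists_isSobolev_edgeFun e hφ1 hz h₀ h₁
      have := hw _ ⟨_, hD e f _ _ hf hf0, rfl⟩
      rw [LinearMap.fst_apply, inner_edgeFun] at this
      refine Eq.trans ?_ this
      rw [← integral_indicator measurableSet_Icc]
      refine integral_congr_ae (Eventually.of_forall fun x => ?_)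
      by_cases hx : x ∈ Set.Icc 0 (G.len e)
      · simp [hx]
      · simp [hx, hz x fun h => hx (Set.Ioo_subset_Icc_self h)]
  have := (Submodule.dense_iff_topologicalClosure_eq_top).2 key
  exact this

/-! ### The forms on graphs are discrete. -/

theorem H1c_le_H1 : G.H1c ≤ G.H1 := fun _ ⟨f, hf, _⟩ => ⟨f, hf⟩

theorem H1c_le_H10 : G.H1c ≤ G.H10 := le_inf H1c_le_H1 G.H1c.le_topologicalClosure

theorem H1Vanishing_le_H1 (A : Set G.Space) : G.H1Vanishing A ≤ G.H1 := fun _ ⟨f, hf, _⟩ => ⟨f, hf⟩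

section Discrete

variable [Countable E] (hconn : G.IsConnected) (hlen : G.totalLength ≠ ⊤)
include hconn hlen

theorem isDiscreteForm_H1 : IsDiscreteForm G.H1 where
  closed := isClosed_H1
  dense := dense_fst_of_forall_mem fun _ f _ _ hf _ => ⟨f, hf⟩
  compact := isCompactForm_H1 hconn hlen

theorem isDiscreteForm_H10 : IsDiscreteForm G.H10 where
  closed := isClosed_H10
  dense := dense_fst_of_forall_mem fun e f _ _ hf h => H1c_le_H10
    ⟨f, hf, G.pt e '' Set.Icc 0 (G.len e), isCompact_Icc.image (G.continuous_pt e),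
      fun x hx => h x fun hx' => hx (Set.image_mono Set.Ioo_subset_Icc_self hx')⟩
  compact := (isCompactForm_H1 hconn hlen).mono inf_le_left

theorem isDiscreteForm_H1Vanishing {A : Set G.Space}
    (hA : ∀ e, ∀ x ∈ Set.Ioo 0 (G.len e), G.pt e x ∉ A) : IsDiscreteForm (G.H1Vanishing A) where
  closed := isClosed_H1Vanishing A
  dense := dense_fst_of_forall_mem fun e f _ _ hf h => ⟨f, hf, fun x hx => h x <| by
    rintro ⟨y, hy, rfl⟩
    exact hA e y hy hx⟩
  compact := (isCompactForm_H1 hconn hlen).mono (H1Vanishing_le_H1 A)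

end Discrete

theorem totalLength_subgraph_ne_top (hlen : G.totalLength ≠ ⊤) (S : Set E) :
    (G.subgraph S).totalLength ≠ ⊤ :=
  ne_top_of_le_ne_top hlen (ENNReal.tsum_comp_le_tsum_of_injective Subtype.val_injective _)

/-! ### Restriction and extension -/

/-- Restriction of square integrable functions to a subgraph. -/
def restrictL2 (G : MetricGraph E) (S : Set E) : G.L2 →L[ℝ] (G.subgraph S).L2 := lpRestrict S

/-- Extension by zero of square integrable functions on a subgraph. -/
def extendL2 (G : MetricGraph E) (S : Set E) : (G.subgraph S).L2 →ₗᵢ[ℝ] G.L2 :=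
  lpExtend (F := G.EdgeL2) S

theorem norm_restrictL2_le (S : Set E) (u : G.L2) : ‖G.restrictL2 S u‖ ≤ ‖u‖ :=
  norm_lpRestrict_le S u

theorem extendL2_of_mem {S : Set E} (u : (G.subgraph S).L2) {e : E} (he : e ∈ S) :
    G.extendL2 S u e = u ⟨e, he⟩ := lpExtend_of_mem (F := G.EdgeL2) u he

theorem extendL2_of_notMem {S : Set E} (u : (G.subgraph S).L2) {e : E} (he : e ∉ S) :
    G.extendL2 S u e = 0 := lpExtend_of_notMem (F := G.EdgeL2) u he

theorem tendsto_extendL2_restrictL2 {K : ℕ → Set E} (hK : Monotone K)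
    (hex : ∀ e, ∃ n, e ∈ K n) (u : G.L2) :
    Tendsto (fun n => G.extendL2 (K n) (G.restrictL2 (K n) u)) atTop (𝓝 u) :=
  tendsto_lpExtend_lpRestrict hK hex u

theorem IsSobolev.restrict {f : G.Space → ℝ} {u g : G.L2} (hf : G.IsSobolev f u g) (S : Set E) :
    (G.subgraph S).IsSobolev (fun P => f (G.incl S P)) (G.restrictL2 S u) (G.restrictL2 S g) where
  cont := hf.cont.comp (G.continuous_incl S)
  ae_eq e := hf.ae_eq e
  integral_eq e x hx := hf.integral_eq e x hx

open Classical in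
/-- Extension of square integrable functions on a subgraph by constants on the other edges. -/
def constExtend (G : MetricGraph E) {S : Set E} (u : (G.subgraph S).L2) (c : E → ℝ) (e : E) :
    G.EdgeL2 e :=
  if h : e ∈ S then u ⟨e, h⟩ else Lp.const 2 (volume.restrict (Set.Icc (0 : ℝ) (G.len e))) (c e)

theorem constExtend_of_mem {S : Set E} (u : (G.subgraph S).L2) (c : E → ℝ) {e : E} (he : e ∈ S) :
    G.constExtend u c e = u ⟨e, he⟩ := dif_pos he

theorem constExtend_of_notMem {S : Set E} (u : (G.subgraph S).L2) (c : E → ℝ) {e : E}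
    (he : e ∉ S) : G.constExtend u c e =
      Lp.const 2 (volume.restrict (Set.Icc (0 : ℝ) (G.len e))) (c e) := dif_neg he

/-- Finite total length makes bounded constants on the edges square summable. -/
theorem memℓp_constExtend (hlen : G.totalLength ≠ ⊤) {S : Set E} (u : (G.subgraph S).L2)
    {c : E → ℝ} {M : ℝ} (hM : ∀ e, |c e| ≤ M) : Memℓp (G.constExtend u c) 2 := by
  rw [memℓp_two_iff]
  refine Summable.of_nonneg_of_le (fun _ => sq_nonneg _) (fun e => ?_)
    ((lp.hasSum_norm_sq (G.extendL2 S u)).summable.add ((summable_len hlen).mul_right (M ^ 2)))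
  have hl := (G.len_pos e).le
  by_cases he : e ∈ S
  · rw [constExtend_of_mem _ _ he, extendL2_of_mem _ he]
    exact le_add_of_nonneg_right (by positivity)
  · rw [constExtend_of_notMem _ _ he]
    refine le_add_of_nonneg_of_le (sq_nonneg _) ?_
    have hM0 : 0 ≤ M := (abs_nonneg _).trans (hM e)
    have := EdgeL2.norm_le_of_ae_bound
      (Lp.const 2 (volume.restrict (Set.Icc (0 : ℝ) (G.len e))) (c e) : G.EdgeL2 e) hM0 (by
        filter_upwards [Lp.coeFn_const (p := 2)
          (μ := volume.restrict (Set.Icc (0 : ℝ) (G.len e))) (c e)] with x hx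
        rw [hx]
        exact hM e)
    calc _ ≤ (√(G.len e) * M) ^ 2 := by gcongr
      _ = _ := by rw [mul_pow, Real.sq_sqrt hl]

/-- Extension of Sobolev functions on a subgraph by constants on the other edges. -/
theorem IsSobolev.exists_extension (hlen : G.totalLength ≠ ⊤) {S : Set E}
    {f : (G.subgraph S).Space → ℝ} {u g : (G.subgraph S).L2} (hf : (G.subgraph S).IsSobolev f u g)
    {c : E → ℝ} {M : ℝ} (hM : ∀ e, |c e| ≤ M)
    (hin : ∀ (a : S × Bool) (b : E × Bool), G.rel ((a.1 : E), a.2) b → b.1 ∉ S →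
      f ((G.subgraph S).pt a.1 ((G.subgraph S).endCoord a)) = c b.1)
    (hout : ∀ a b : E × Bool, G.rel a b → a.1 ∉ S → b.1 ∉ S → c a.1 = c b.1) :
    ∃ f' u', G.IsSobolev f' u' (G.extendL2 S g) ∧ G.restrictL2 S u' = u ∧
      ∀ e ∉ S, ∀ x, f' (G.pt e x) = c e := by
  classical
  obtain ⟨f', hf'⟩ := G.exists_fun
    -- The values agree at glued endpoints: `hin` treats vertices shared with the subgraph, `hout`
    -- those between two outside edges.
    (fun e x => if h : e ∈ S then f ((G.subgraph S).pt ⟨e, h⟩ x) else c e) (fun a b hab => by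
      by_cases ha : a.1 ∈ S <;> by_cases hb : b.1 ∈ S
      · rw [dif_pos ha, dif_pos hb]
        exact congrArg f ((G.subgraph S).pt_endCoord_eq
          (a := (⟨a.1, ha⟩, a.2)) (b := (⟨b.1, hb⟩, b.2)) hab)
      · rw [dif_pos ha, dif_neg hb]
        exact hin (⟨a.1, ha⟩, a.2) b hab hb
      · rw [dif_neg ha, dif_pos hb]
        exact (hin (⟨b.1, hb⟩, b.2) a (G.rel.symm hab) ha).symm
      · rw [dif_neg ha, dif_neg hb]
        exact hout a b hab ha hb)
  have hS : ∀ e (he : e ∈ S), ∀ x ∈ Set.Icc 0 (G.len e),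
      f' (G.pt e x) = f ((G.subgraph S).pt ⟨e, he⟩ x) := fun e he x hx => by
    rw [hf' e x hx, dif_pos he]
  have hS' : ∀ e ∉ S, ∀ x ∈ Set.Icc 0 (G.len e), f' (G.pt e x) = c e := fun e he x hx => by
    rw [hf' e x hx, dif_neg he]
  refine ⟨f', ⟨G.constExtend u c, memℓp_constExtend hlen u hM⟩,
    ⟨G.continuous_of_edges fun e => ?_, fun e => ?_, fun e x hx => ?_⟩, ?_, fun e he x => ?_⟩
  · by_cases he : e ∈ S
    · exact (hf.cont.comp ((G.subgraph S).continuous_pt ⟨e, he⟩)).continuousOn.congr (hS e he)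
    · exact continuousOn_const.congr (hS' e he)
  · change ∀ᵐ x ∂_, G.constExtend u c e x = _
    by_cases he : e ∈ S
    · rw [constExtend_of_mem _ _ he]
      filter_upwards [hf.ae_eq ⟨e, he⟩, ae_restrict_mem measurableSet_Icc] with x hx hxI
      exact hx.trans (hS e he x hxI).symm
    · rw [constExtend_of_notMem _ _ he]
      filter_upwards [Lp.coeFn_const (p := 2)
          (μ := volume.restrict (Set.Icc (0 : ℝ) (G.len e))) (c e),
        ae_restrict_mem measurableSet_Icc] with x hx hxI
      rw [hS' e he x hxI, hx]
      rfl
  · have h0 : (0 : ℝ) ∈ Set.Icc 0 (G.len e) := ⟨le_rfl, (G.len_pos e).le⟩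
    by_cases he : e ∈ S
    · rw [extendL2_of_mem _ he, hS e he x hx, hS e he 0 h0]
      exact hf.integral_eq ⟨e, he⟩ x hx
    · rw [extendL2_of_notMem _ he, integral_zero_edge _ hx, hS' e he x hx, hS' e he 0 h0, add_zero]
  · ext e : 2
    exact constExtend_of_mem u c e.2
  · have : G.pt e x = G.pt e (Set.projIcc 0 (G.len e) (G.len_pos e).le x) := by
      rw [pt, pt, Set.projIcc_val]
    rw [this]
    exact hS' e he _ (Subtype.property _)

/-! ### Chains of a graph and of its subgraphs -/

/-- The boundaries of the chains supported in a set of edges. -/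
def boundaries (G : MetricGraph E) (S : Set E) : Submodule ℝ (G.Vertex →₀ ℝ) :=
  (Finsupp.supported ℝ ℝ S).map G.boundaryMap

/-- The class of a vertex modulo the boundaries of the chains supported in a set of edges. -/
def vertexClass (G : MetricGraph E) (S : Set E) (v : G.Vertex) : (G.Vertex →₀ ℝ) ⧸ G.boundaries S :=
  (G.boundaries S).mkQ (Finsupp.single v 1)

theorem vertexClass_eq_iff {S : Set E} {v w : G.Vertex} :
    G.vertexClass S v = G.vertexClass S w ↔
      Finsupp.single v 1 - Finsupp.single w 1 ∈ G.boundaries S :=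
  Submodule.Quotient.eq _

theorem vertexClass_ends {S : Set E} {e : E} (he : e ∈ S) :
    G.vertexClass S (G.vertexAt (e, true)) = G.vertexClass S (G.vertexAt (e, false)) := by
  rw [vertexClass_eq_iff]
  refine ⟨Finsupp.single e 1, Finsupp.single_mem_supported ℝ 1 he, ?_⟩
  simp [boundaryMap]

theorem vertexClass_vertexAt {S : Set E} {a : E × Bool} (ha : a.1 ∈ S) :
    G.vertexClass S (G.vertexAt a) = G.vertexClass S (G.vertexAt (a.1, false)) := by
  obtain ⟨e, b⟩ := a
  cases b
  · rfl
  · exact vertexClass_ends ha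

/-- In a connected subgraph all vertices are homologous. -/
theorem vertexClass_eq_of_isConnected {S : Set E} (hS : (G.subgraph S).IsConnected)
    {a b : E × Bool} (ha : a.1 ∈ S) (hb : b.1 ∈ S) :
    G.vertexClass S (G.vertexAt a) = G.vertexClass S (G.vertexAt b) := by
  have hS' : ConnectedSpace (G.subgraph S).Space := hS
  -- With the discrete topology, the map sending each point of an edge to the common class of its
  -- two ends is continuous, hence constant on the connected subgraph.
  let : TopologicalSpace ((G.Vertex →₀ ℝ) ⧸ G.boundaries S) := ⊥
  have : DiscreteTopology ((G.Vertex →₀ ℝ) ⧸ G.boundaries S) := ⟨rfl⟩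
  obtain ⟨f, hf⟩ := (G.subgraph S).exists_fun
    (fun e _ => G.vertexClass S (G.vertexAt ((e : E), false))) (fun a b hab => by
      have h : G.vertexAt ((a.1 : E), a.2) = G.vertexAt ((b.1 : E), b.2) := Quotient.sound hab
      have h1 := vertexClass_vertexAt (G := G) (a := ((a.1 : E), a.2)) a.1.2
      have h2 := vertexClass_vertexAt (G := G) (a := ((b.1 : E), b.2)) b.1.2
      rw [← h1, ← h2, h])
  have hcont : Continuous f := (G.subgraph S).continuous_of_edges fun e =>
    continuousOn_const.congr (hf e)
  have hconst := PreconnectedSpace.constant (α := (G.subgraph S).Space) inferInstance hcont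
    (x := (G.subgraph S).pt ⟨a.1, ha⟩ 0) (y := (G.subgraph S).pt ⟨b.1, hb⟩ 0)
  rw [hf _ _ ⟨le_rfl, ((G.subgraph S).len_pos _).le⟩,
    hf _ _ ⟨le_rfl, ((G.subgraph S).len_pos _).le⟩] at hconst
  rw [vertexClass_vertexAt ha, vertexClass_vertexAt hb]
  exact hconst

/-- If a connected subgraph contains all cycles, its vertices are not connected outside. -/
theorem vertexAt_eq_of_vertexClass_compl_eq {S : Set E} (hS : (G.subgraph S).IsConnected)
    (hker : LinearMap.ker G.boundaryMap ≤ Finsupp.supported ℝ ℝ S) {a b : E × Bool}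
    (ha : a.1 ∈ S) (hb : b.1 ∈ S)
    (h : G.vertexClass Sᶜ (G.vertexAt a) = G.vertexClass Sᶜ (G.vertexAt b)) :
    G.vertexAt a = G.vertexAt b := by
  obtain ⟨c, hc, hcb⟩ := vertexClass_eq_iff.1 h
  obtain ⟨d, hd, hdb⟩ := vertexClass_eq_iff.1 (vertexClass_eq_of_isConnected hS ha hb)
  -- The chains `c` outside and `d` inside `S` have the same boundary. Their difference is a cycle,
  -- hence supported in `S`, so `c` is supported both in `S` and outside it and vanishes; then the
  -- two vertices coincide.
  have hcd : c - d ∈ LinearMap.ker G.boundaryMap := by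
    rw [LinearMap.mem_ker, map_sub, hcb, hdb, sub_self]
  have hcS : c ∈ Finsupp.supported ℝ ℝ S := by
    have := add_mem (hker hcd) hd
    rwa [sub_add_cancel] at this
  have hc0 : c = 0 := by
    have := Submodule.disjoint_def.1 (Finsupp.disjoint_supported_supported (M := ℝ) (R := ℝ)
      (disjoint_compl_right (a := S))) c hcS hc
    exact this
  rw [hc0, map_zero] at hcb
  exact Finsupp.single_left_injective one_ne_zero (sub_eq_zero.1 hcb.symm)

/-- A finite Betti number means that finitely many cycles span the cycle space, and each uses
finitely many edges. -/
theorem eventually_ker_boundaryMap_le (hG : G.betti ≠ ⊤) {K : ℕ → Set E} (hK : Monotone K)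
    (hex : ∀ e, ∃ n, e ∈ K n) :
    ∀ᶠ n in atTop, LinearMap.ker G.boundaryMap ≤ Finsupp.supported ℝ ℝ (K n) := by
  classical
  have hlt : Module.rank ℝ (LinearMap.ker G.boundaryMap) < Cardinal.aleph0 := by
    rw [betti, Ne, Cardinal.toENat_eq_top, not_le] at hG
    exact hG
  have : IsNoetherian ℝ (LinearMap.ker G.boundaryMap) :=
    (@IsNoetherian.iff_rank_lt_aleph0 ℝ (LinearMap.ker G.boundaryMap) _
      (Submodule.addCommGroup _) _).2 hlt
  obtain ⟨s, hs⟩ := (IsNoetherian.noetherian (⊤ : Submodule ℝ (LinearMap.ker G.boundaryMap))).map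
    (Submodule.subtype _)
  obtain ⟨n, hn⟩ := hK.directed_le.exists_mem_subset_of_finset_subset_biUnion
    (s := s.biUnion Finsupp.support) fun e _ => Set.mem_iUnion.2 (hex e)
  filter_upwards [eventually_ge_atTop n] with m hm
  rw [← Submodule.range_subtype (LinearMap.ker G.boundaryMap), ← Submodule.map_top, ← hs,
    Submodule.span_le]
  intro c hc e he
  exact hK hm (hn (Finset.mem_coe.2 (Finset.mem_biUnion.2 ⟨c, hc, he⟩)))

/-- If a finite connected subgraph contains all cycles, Sobolev functions on it extend to Sobolev
functions on the graph which are constant on the components of the complement. -/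
theorem IsSobolev.exists_extension_of_ker_le (hlen : G.totalLength ≠ ⊤) {S : Set E} (hfin : S.Finite)
    (hS : (G.subgraph S).IsConnected)
    (hker : LinearMap.ker G.boundaryMap ≤ Finsupp.supported ℝ ℝ S)
    {f : (G.subgraph S).Space → ℝ} {u g : (G.subgraph S).L2} (hf : (G.subgraph S).IsSobolev f u g) :
    ∃ f' u', G.IsSobolev f' u' (G.extendL2 S g) ∧ G.restrictL2 S u' = u := by
  classical
  let val : S × Bool → ℝ := fun a => f ((G.subgraph S).pt a.1 ((G.subgraph S).endCoord a))
  let P : (G.Vertex →₀ ℝ) ⧸ G.boundaries Sᶜ → S × Bool → Prop := fun q a =>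
    G.vertexClass Sᶜ (G.vertexAt ((a.1 : E), a.2)) = q
  -- A class modulo chains outside `S` plays the role of a component of the complement. It contains
  -- at most one vertex of the subgraph, so the choice does not matter; a class without one gets the
  -- default `0`, hence `max M 0` as the bound below.
  let F : (G.Vertex →₀ ℝ) ⧸ G.boundaries Sᶜ → ℝ := fun q =>
    if h : ∃ a, P q a then val h.choose else 0
  have hF : ∀ a : S × Bool, F (G.vertexClass Sᶜ (G.vertexAt ((a.1 : E), a.2))) = val a := by
    intro a
    have h : ∃ a', P (G.vertexClass Sᶜ (G.vertexAt ((a.1 : E), a.2))) a' := ⟨a, rfl⟩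
    have h1 := vertexAt_eq_of_vertexClass_compl_eq hS hker h.choose.1.2 a.1.2 h.choose_spec
    have h2 : G.rel ((h.choose.1 : E), h.choose.2) ((a.1 : E), a.2) := Quotient.exact h1
    change (if h : ∃ a', P _ a' then val h.choose else 0) = _
    rw [dif_pos h]
    exact congrArg f ((G.subgraph S).pt_endCoord_eq (a := h.choose) (b := a) h2)
  have hSfin : Finite S := hfin
  obtain ⟨M, hM⟩ : ∃ M, ∀ a, |val a| ≤ M := by
    obtain ⟨M, hM⟩ := (Set.finite_range fun a => |val a|).bddAbove
    exact ⟨M, fun a => hM ⟨a, rfl⟩⟩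
  suffices h : ∃ f' u', G.IsSobolev f' u' (G.extendL2 S g) ∧ G.restrictL2 S u' = u ∧
      ∀ e ∉ S, ∀ x, f' (G.pt e x) = F (G.vertexClass Sᶜ (G.vertexAt (e, false))) by
    obtain ⟨f', u', h1, h2, -⟩ := h
    exact ⟨f', u', h1, h2⟩
  refine hf.exists_extension hlen (M := max M 0) (fun e => ?_) (fun a b hab hb => ?_)
    (fun a b hab ha hb => ?_)
  · by_cases h : ∃ a', P (G.vertexClass Sᶜ (G.vertexAt (e, false))) a'
    · simp only [F, dif_pos h]
      exact (hM _).trans (le_max_left _ _)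
    · simp only [F, dif_neg h, abs_zero]
      exact le_max_right _ _
  · have h : G.vertexAt ((a.1 : E), a.2) = G.vertexAt b := Quotient.sound hab
    rw [← vertexClass_vertexAt (G := G) (S := Sᶜ) hb, ← h]
    exact (hF a).symm
  · have h : G.vertexAt a = G.vertexAt b := Quotient.sound hab
    change F _ = F _
    rw [← vertexClass_vertexAt (G := G) (S := Sᶜ) hb, ← vertexClass_vertexAt (G := G) (S := Sᶜ) ha, h]

/-- Sobolev functions on a finite subgraph which vanish on the boundary extend by zero. -/
theorem IsSobolev.exists_extension_of_bdry (hlen : G.totalLength ≠ ⊤) {S : Set E} (hfin : S.Finite)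
    {f : (G.subgraph S).Space → ℝ} {u g : (G.subgraph S).L2} (hf : (G.subgraph S).IsSobolev f u g)
    (hf0 : ∀ P ∈ G.bdry S, f P = 0) :
    ∃ u', (u', G.extendL2 S g) ∈ G.H1c ∧ G.restrictL2 S u' = u := by
  obtain ⟨f', u', h1, h2, h3⟩ := hf.exists_extension hlen (c := fun _ => 0) (M := 0)
    (fun _ => by simp) (fun a b hab hb => hf0 _ (G.pt_endCoord_mem_bdry hab hb)) (fun _ _ _ _ _ => rfl)
  refine ⟨u', ⟨f', h1, Set.range (G.incl S), G.isCompact_range_incl hfin, fun P hP => ?_⟩, h2⟩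
  obtain ⟨e, x, hx, rfl⟩ := G.exists_pt P
  exact h3 e (fun he => hP (G.pt_mem_range_incl he x)) x

/-- Compactly supported Sobolev functions restrict to functions vanishing on the boundary of large
members of an exhaustion. -/
theorem eventually_restrict_mem_H1Vanishing (hG : G.LocallyFinite) {K : ℕ → Set E}
    (hK : Monotone K) (hex : ∀ e, ∃ n, e ∈ K n) {p : G.L2 × G.L2} (hp : p ∈ G.H1c) :
    ∀ᶠ n in atTop, (G.restrictL2 (K n) p.1, G.restrictL2 (K n) p.2) ∈
      (G.subgraph (K n)).H1Vanishing (G.bdry (K n)) := by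
  obtain ⟨f, hf, C, hC, hfC⟩ := hp
  obtain ⟨n, hn⟩ := hG.exists_disjoint hK hex hC
  filter_upwards [eventually_ge_atTop n] with m hm
  refine ⟨_, hf.restrict (K m), fun Q hQ => G.eq_zero_of_mem_bdry hf.cont (fun P hP => ?_) hQ⟩
  obtain ⟨e, x, hx, rfl⟩ := G.exists_pt P
  exact hfC _ (hn e (fun he => hP (G.pt_mem_range_incl (hK hm he) x)) x)

end MetricGraph

end

/-! ### Comparison of the eigenvalues along the exhaustion. -/

theorem mainTheorem12 {E : Type*} [Countable E] (G : MetricGraph E)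
    (hlf : G.LocallyFinite) (hconn : G.IsConnected) (hlen : G.totalLength ≠ ⊤)
    (K : ℕ → Set E) (hK : G.IsCompactExhaustion K) :
    -- all operators involved have purely discrete spectrum
    (HasPurelyDiscreteSpectrum G.friedrichsLaplacian ∧
      HasPurelyDiscreteSpectrum G.neumannLaplacian ∧
      ∀ n, HasPurelyDiscreteSpectrum (G.dirichletLaplacianOn (K n)) ∧
        HasPurelyDiscreteSpectrum (G.neumannLaplacianOn (K n))) ∧
    -- Dirichlet eigenvalues
    (∀ k : ℕ, 1 ≤ k →
      (∀ n, kthEigenvalue G.friedrichsLaplacian k ≤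
        kthEigenvalue (G.dirichletLaplacianOn (K n)) k) ∧
      Tendsto (fun n => kthEigenvalue (G.dirichletLaplacianOn (K n)) k) atTop
        (𝓝 (kthEigenvalue G.friedrichsLaplacian k))) ∧
    -- Neumann eigenvalues
    (∀ k : ℕ, 1 ≤ k →
      limsup (fun n => kthEigenvalue (G.neumannLaplacianOn (K n)) k) atTop ≤
        kthEigenvalue G.neumannLaplacian k) ∧
    -- Neumann eigenvalues when the first Betti number is finite
    (G.betti ≠ ⊤ → ∀ k : ℕ, 1 ≤ k → ∀ᶠ n in atTop,
      kthEigenvalue G.neumannLaplacian k ≤ kthEigenvalue (G.neumannLaplacianOn (K n)) k) := by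
  have hmono : Monotone K := monotone_nat_of_le_succ hK.mono
  have hF : IsDiscreteForm G.H10 := MetricGraph.isDiscreteForm_H10 hconn hlen
  have hN : IsDiscreteForm G.H1 := MetricGraph.isDiscreteForm_H1 hconn hlen
  have hlenK := fun n => MetricGraph.totalLength_subgraph_ne_top hlen (K n)
  have hDn : ∀ n, IsDiscreteForm ((G.subgraph (K n)).H1Vanishing (G.bdry (K n))) := fun n =>
    MetricGraph.isDiscreteForm_H1Vanishing (hK.connected n) (hlenK n)
      fun e x hx => G.pt_notMem_bdry e hx
  have hNn : ∀ n, IsDiscreteForm (G.subgraph (K n)).H1 := fun n =>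
    MetricGraph.isDiscreteForm_H1 (hK.connected n) (hlenK n)
  have hle : ∀ k : ℕ, 1 ≤ k → ∀ n, kthEigenvalue G.friedrichsLaplacian k ≤
      kthEigenvalue (G.dirichletLaplacianOn (K n)) k := fun k hk n =>
    (hDn n).kthEigenvalue_le_kthEigenvalue hF hk (G.extendL2 (K n)) (G.restrictL2 (K n))
      (MetricGraph.norm_restrictL2_le _) fun p ⟨f, hf, hf0⟩ => by
        obtain ⟨u', h1, h2⟩ := hf.exists_extension_of_bdry hlen (hK.compact n) hf0
        exact ⟨_, MetricGraph.H1c_le_H10 h1, rfl, h2⟩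
  refine ⟨⟨hF.hasPurelyDiscreteSpectrum, hN.hasPurelyDiscreteSpectrum, fun n =>
    ⟨(hDn n).hasPurelyDiscreteSpectrum, (hNn n).hasPurelyDiscreteSpectrum⟩⟩,
    fun k hk => ⟨hle k hk, ?_⟩, fun k hk => ?_, fun hb k hk => ?_⟩
  · refine tendsto_order.2 ⟨fun a ha => Eventually.of_forall fun n => ha.trans_le (hle k hk n),
      fun a ha => ?_⟩
    obtain ⟨t, ht, hta⟩ := EReal.lt_iff_exists_real_btwn.1 ha
    -- Here the core is `H1c`: `H10` lies in its closure by definition, and each of its elements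
    -- restricts to the Dirichlet form domain for large `n`.
    filter_upwards [hF.eventually_kthEigenvalue_le inf_le_right hk hDn
      (fun n => G.extendL2 (K n)) (fun n => G.restrictL2 (K n))
      (MetricGraph.tendsto_extendL2_restrictL2 hmono hK.exhaust)
      (fun p hp => MetricGraph.eventually_restrict_mem_H1Vanishing hlf hmono hK.exhaust hp) ht]
      with n hn
    exact lt_of_le_of_lt hn hta
  · refine EReal.le_of_forall_lt_iff_le.1 fun t ht => ?_
    refine limsup_le_of_le (h := ?_)
    -- The core is all of `H1`, as restriction to a subgraph meets no boundary condition.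
    exact hN.eventually_kthEigenvalue_le G.H1.le_topologicalClosure hk hNn
      (fun n => G.extendL2 (K n)) (fun n => G.restrictL2 (K n))
      (MetricGraph.tendsto_extendL2_restrictL2 hmono hK.exhaust)
      (fun p ⟨f, hf⟩ => Eventually.of_forall fun n => ⟨_, hf.restrict (K n)⟩) ht
  · filter_upwards [MetricGraph.eventually_ker_boundaryMap_le hb hmono hK.exhaust] with n hn
    refine (hNn n).kthEigenvalue_le_kthEigenvalue hN hk (G.extendL2 (K n)) (G.restrictL2 (K n))
      (MetricGraph.norm_restrictL2_le _) fun p ⟨f, hf⟩ => ?_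
    obtain ⟨f', u', h1, h2⟩ := hf.exists_extension_of_ker_le hlen (hK.compact n) (hK.connected n) hn
    exact ⟨(u', _), ⟨f', h1⟩, rfl, h2⟩
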